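/- Let $n\ge 0$ be an integer and let $\mathbf{Gr}(n,\mathbb C^{2n})$ be the complex manifold of $n$-dimensional complex subspaces of $\mathbb C^{2n}$, on which $g\in GL(2n,\mathbb C)$ acts by $\sigma_g(z)=gz$. Consider the holomorphic vector bundles over $\mathbf{Gr}(n,\mathbb C^{2n})$ with total spaces $$\mathcal N=\{(\mathcal Z,z)\in \mathbf{gl}(2n,\mathbb C)\times\mathbf{Gr}(n,\mathbb C^{2n}) : \operatorname{Im}\mathcal Z\subset z\subset\operatorname{Ker}\mathcal Z\},$$ $$\mathcal E=\{(w,z)\in\mathbb C^{2n}\times\mathbf{Gr}(n,\mathbb C^{2n}) : w\in z\},\qquad \mathcal E^{\bot}=\{(\varphi,z)\in(\mathbb C^{2n})^*\times\mathbf{Gr}(n,\mathbb C^{2n}) : \varphi|_z=0\},$$ their tensor product $\mathcal E\otimes\mathcal E^\bot$, and the holomorphic cotangent bundle $T^*\mathbf{Gr}(n,\mathbb C^{2n})$. For $g\in GL(2n,\mathbb C)$ put $\Sigma_g(\mathcal Z,z)=(g\mathcal Zg^{-1},gz)$, $T_g(w,z)=(gw,gz)$, $T^*_g(\varphi,z)=(\varphi\circ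 g^{-1},gz)$, and let $T^*\sigma_g$ be the cotangent lift $(\alpha,z)\mapsto(\alpha\circ(d\sigma_g(z))^{-1},gz)$. (i) There are isomorphisms of holomorphic vector bundles over $\mathbf{Gr}(n,\mathbb C^{2n})$ $$\mathcal N\;\cong\;\mathcal E\otimes\mathcal E^\bot\;\cong\;T^*\mathbf{Gr}(n,\mathbb C^{2n}),$$ which are canonical in the following sense. The first one corresponds to $w\otimes\varphi\mapsto(v\mapsto\varphi(v)w)$. The composition of the two sends $\mathcal Z\in\mathcal N_z$ to the covector $X\mapsto\operatorname{Tr}(\mathcal Z\cdot d\phi_p(z)X)$ for every idempotent $p$ with $\operatorname{Im}p=z$, where $\phi_p(z')=q_{z'}-p$ and $q_{z'}$ is the projection of $\mathbb C^{2n}$ onto $z'$ along $\operatorname{Ker}p$, for $z'$ with $z'\oplus\operatorname{Ker}p=\mathbb C^{2n}$. (ii) $\Sigma_g$, $T_g\otimes T_g^*$ and $T^*\sigma_g$ define actions of $GL(2n,\mathbb C)$ on $\mathcal N$, $\mathcal E\otimes\mathcal E^\bot$ and $T^*\mathbf{Gr}(n,\mathbb C^{2n})$, respectively, by holomorphic vector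 bundle automorphisms covering $\sigma_g$, and the isomorphisms of (i) are $GL(2n,\mathbb C)$-equivariant. (iii) $\mathcal N$ is the disjoint union of the sets $$\mathcal N^k=\{(\mathcal Z,z)\in\mathcal N : \dim_{\mathbb C}\operatorname{Im}\mathcal Z=k\},\qquad k=0,1,\dots,n,$$ and each $\mathcal N^k$ is a single $GL(2n,\mathbb C)$-orbit. Consequently $\mathcal E\otimes\mathcal E^\bot$ and $T^*\mathbf{Gr}(n,\mathbb C^{2n})$ are the disjoint unions of the images of $\mathcal N^0,\dots,\mathcal N^n$ under the isomorphisms of (i), and each image is a single $GL(2n,\mathbb C)$-orbit. -/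

import Mathlib

open Set Bundle Topology
open scoped Manifold ContDiff TensorProduct Topology

noncomputable section

namespace GrBundles

/-- The space `ℂ²ⁿ`. -/
abbrev V (n : ℕ) : Type := Fin (2 * n) → ℂ

/-- The space `ℂⁿ`. -/
abbrev K (n : ℕ) : Type := Fin n → ℂ

/-- The space of `n × n` complex matrices, as the endomorphisms of `ℂⁿ`. -/
abbrev M (n : ℕ) : Type := K n →L[ℂ] K n

/-- The Lie algebra `gl(2n, ℂ)`. -/
abbrev gl (n : ℕ) : Type := V n →L[ℂ] V n

/-- The group `GL(2n, ℂ)` of invertible linear maps of `ℂ²ⁿ`. -/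
abbrev GL2 (n : ℕ) : Type := V n ≃L[ℂ] V n

/-- The Grassmannian of `n`-dimensional complex subspaces of `ℂ²ⁿ`. -/
@[ext]
structure Gr (n : ℕ) : Type where
  space : Submodule ℂ (V n)
  finrank_eq : Module.finrank ℂ space = n

variable {n : ℕ}

/-- The natural action `σ_g(z) = g z` of `GL(2n, ℂ)` on the Grassmannian. -/
instance : MulAction (GL2 n) (Gr n) where
  smul g z := ⟨z.space.map (g.toLinearEquiv : V n →ₗ[ℂ] V n), by
    rw [LinearEquiv.finrank_map_eq]; exact z.finrank_eq⟩
  one_smul z := by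
    ext x; exact ⟨fun ⟨y, hy, h⟩ => by rw [← h]; exact hy, fun h => ⟨x, h, rfl⟩⟩
  mul_smul g h z := by
    ext x
    constructor
    · rintro ⟨y, hy, rfl⟩; exact ⟨h y, ⟨y, hy, rfl⟩, rfl⟩
    · rintro ⟨_, ⟨y, hy, rfl⟩, rfl⟩; exact ⟨y, hy, rfl⟩

theorem mem_smul_of_mem (g : GL2 n) {z : Gr n} {w : V n} (h : w ∈ z.space) :
    g w ∈ (g • z).space := ⟨w, h, rfl⟩

theorem inv_mem_of_mem_smul (g : GL2 n) {z : Gr n} {w : V n} (h : w ∈ (g • z).space) :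
    g.symm w ∈ z.space := by
  obtain ⟨y, hy, rfl⟩ := h
  simpa using hy

/-! ### The complex manifold structure of the Grassmannian -/

/-- A splitting of `ℂ²ⁿ` into two copies of `ℂⁿ`; equivalently an idempotent `p` of rank `n`
with a basis of `Im p` and a basis of `Im (1 - p)`. -/
abbrev Split (n : ℕ) : Type := V n ≃L[ℂ] K n × K n

/-- The map `k ↦ e⁻¹(k, A k)`. -/
def graphMap (e : Split n) (A : M n) : K n →L[ℂ] V n :=
  (e.symm : K n × K n →L[ℂ] V n) ∘L
    (ContinuousLinearMap.inl ℂ (K n) (K n) + ContinuousLinearMap.inr ℂ (K n) (K n) ∘L A)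

theorem graphMap_apply (e : Split n) (A : M n) (k : K n) :
    graphMap e A k = e.symm (k, A k) := by
  simp [graphMap, ← map_add]

theorem graphMap_injective (e : Split n) (A : M n) : Function.Injective (graphMap e A) := by
  intro k l h
  rw [graphMap_apply, graphMap_apply] at h
  exact (Prod.ext_iff.1 (e.symm.injective h)).1

/-- The subspace of `ℂ²ⁿ` which the splitting `e` turns into the graph of `A`. -/
def graph (e : Split n) (A : M n) : Gr n where
  space := LinearMap.range (graphMap e A : K n →ₗ[ℂ] V n)
  finrank_eq := by
    rw [LinearMap.finrank_range_of_inj (graphMap_injective e A)]; simp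

theorem mem_graph {e : Split n} {A : M n} {w : V n} :
    w ∈ (graph e A).space ↔ (e w).2 = A (e w).1 := by
  constructor
  · rintro ⟨k, rfl⟩
    simp [graphMap_apply]
  · intro h
    refine ⟨(e w).1, ?_⟩
    simp [graphMap_apply, ← h]

theorem graph_injective (e : Split n) : Function.Injective (graph e) := by
  intro A B h
  ext1 k
  have : graphMap e A k ∈ (graph e B).space := by rw [← h]; exact ⟨k, rfl⟩
  rw [mem_graph] at this
  simpa [graphMap_apply] using this

/-- The standard affine chart of the Grassmannian given by a splitting `e`: it is defined on the
subspaces which are the graph (with respect to `e`) of a linear map, and sends such a subspace to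
this linear map. -/
def grChart (e : Split n) : PartialEquiv (Gr n) (M n) where
  toFun := Function.invFun (graph e)
  invFun := graph e
  source := Set.range (graph e)
  target := Set.univ
  map_source' _ _ := Set.mem_univ _
  map_target' A _ := ⟨A, rfl⟩
  left_inv' _ h := Function.invFun_eq h
  right_inv' A _ := Function.leftInverse_invFun (graph_injective e) A

theorem mem_iff_of_mem_source {e : Split n} {z : Gr n} (h : z ∈ (grChart e).source) {w : V n} :
    w ∈ z.space ↔ (e w).2 = grChart e z (e w).1 := by
  conv_lhs => rw [← (grChart e).left_inv h]
  exact mem_graph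

/-- The block `a + c A` of the transition between two charts. -/
def blockA (e e' : Split n) (A : M n) : M n :=
  ContinuousLinearMap.fst ℂ (K n) (K n) ∘L (e' : V n →L[ℂ] K n × K n) ∘L graphMap e A

/-- The block `b + d A` of the transition between two charts. -/
def blockB (e e' : Split n) (A : M n) : M n :=
  ContinuousLinearMap.snd ℂ (K n) (K n) ∘L (e' : V n →L[ℂ] K n × K n) ∘L graphMap e A

theorem contDiff_graphMap (e : Split n) : ContDiff ℂ ω (graphMap e) := by
  unfold graphMap
  fun_prop

theorem contDiff_blockA (e e' : Split n) : ContDiff ℂ ω (blockA e e') := by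
  unfold blockA
  have := contDiff_graphMap e
  fun_prop

theorem contDiff_blockB (e e' : Split n) : ContDiff ℂ ω (blockB e e') := by
  unfold blockB
  have := contDiff_graphMap e
  fun_prop

theorem graph_eq_of_isUnit {e e' : Split n} {A : M n} (h : IsUnit (blockA e e' A)) :
    graph e A = graph e' (blockB e e' A * Ring.inverse (blockA e e' A)) := by
  ext w
  rw [mem_graph (e := e')]
  have h1 : ∀ k, Ring.inverse (blockA e e' A) (blockA e e' A k) = k := fun k => by
    rw [← mul_apply_eq_comp, Ring.inverse_mul_cancel _ h]; rfl
  have h2 : ∀ k, blockA e e' A (Ring.inverse (blockA e e' A) k) = k := fun k => by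
    rw [← mul_apply_eq_comp, Ring.mul_inverse_cancel _ h]; rfl
  constructor
  · rintro ⟨k, rfl⟩
    have h3 := h1 k
    change Ring.inverse (blockA e e' A) (e' (graphMap e A k)).1 = k at h3
    change (e' (graphMap e A k)).2 = blockB e e' A (Ring.inverse (blockA e e' A)
      (e' (graphMap e A k)).1)
    rw [h3]
    rfl
  · intro hw
    refine ⟨Ring.inverse (blockA e e' A) (e' w).1, e'.injective (Prod.ext ?_ ?_)⟩
    · exact h2 _
    · exact hw.symm

theorem isUnit_of_graph_eq {e e' : Split n} {A B : M n} (h : graph e A = graph e' B) :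
    IsUnit (blockA e e' A) := by
  have hinj : Function.Injective (blockA e e' A) := by
    rw [injective_iff_map_eq_zero]
    intro k hk
    have hmem : graphMap e A k ∈ (graph e' B).space := by rw [← h]; exact ⟨k, rfl⟩
    rw [mem_graph] at hmem
    have hk' : (e' (graphMap e A k)).1 = 0 := hk
    rw [hk', map_zero] at hmem
    have : e' (graphMap e A k) = 0 := Prod.ext hk' hmem
    have h0 : graphMap e A k = 0 := by simpa using this
    exact graphMap_injective e A (by rw [h0, map_zero])
  let f : K n ≃ₗ[ℂ] K n := LinearEquiv.ofInjectiveEndo (blockA e e' A : K n →ₗ[ℂ] K n) hinj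
  refine ⟨ContinuousLinearEquiv.toUnit f.toContinuousLinearEquiv, ?_⟩
  ext1 k
  rfl

theorem trans_source (e e' : Split n) :
    ((grChart e).symm.trans (grChart e')).source = {A | IsUnit (blockA e e' A)} := by
  ext A
  simp only [PartialEquiv.trans_source, PartialEquiv.symm_source, mem_inter_iff, mem_preimage,
    mem_ofPred_eq]
  constructor
  · rintro ⟨-, B, hB⟩
    exact isUnit_of_graph_eq hB.symm
  · intro h
    exact ⟨mem_univ _, _, (graph_eq_of_isUnit h).symm⟩

theorem trans_eqOn (e e' : Split n) :
    EqOn ((grChart e).symm.trans (grChart e'))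
      (fun A => blockB e e' A * Ring.inverse (blockA e e' A))
      ((grChart e).symm.trans (grChart e')).source := by
  intro A hA
  rw [trans_source] at hA
  change Function.invFun (graph e') (graph e A) = _
  rw [graph_eq_of_isUnit hA]
  exact Function.leftInverse_invFun (graph_injective e') _

theorem contDiffOn_trans (e e' : Split n) :
    ContDiffOn ℂ ω ((grChart e).symm.trans (grChart e'))
      ((grChart e).symm.trans (grChart e')).source := by
  refine ContDiffOn.congr ?_ (trans_eqOn e e')
  rw [trans_source]
  intro A hA
  obtain ⟨u, hu⟩ : IsUnit (blockA e e' A) := hA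
  have h1 : ContDiffAt ℂ ω Ring.inverse (blockA e e' A) := hu ▸ contDiffAt_ringInverse ℂ u
  have h2 : ContDiffAt ℂ ω (fun A => Ring.inverse (blockA e e' A)) A :=
    h1.comp A (contDiff_blockA e e').contDiffAt
  exact ((contDiff_blockB e e').contDiffAt.clm_comp h2).contDiffWithinAt

theorem isOpen_trans_source (e e' : Split n) :
    IsOpen ((grChart e).symm.trans (grChart e')).source := by
  rw [trans_source]
  exact Units.isOpen.preimage (contDiff_blockA e e').continuous

/-- Every point of the Grassmannian is the centre of a chart. -/
theorem exists_split (z : Gr n) : ∃ e : Split n, graph e 0 = z := by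
  obtain ⟨c, hc⟩ := z.space.exists_isCompl
  have hdim : Module.finrank ℂ c = n := by
    have h1 := Submodule.finrank_add_eq_of_isCompl hc
    have h2 := z.finrank_eq
    simp only [Module.finrank_fintype_fun_eq_card, Fintype.card_fin] at h1
    omega
  let f : z.space ≃ₗ[ℂ] K n := LinearEquiv.ofFinrankEq _ _ (by rw [z.finrank_eq]; simp)
  let g : c ≃ₗ[ℂ] K n := LinearEquiv.ofFinrankEq _ _ (by rw [hdim]; simp)
  let e₀ : (K n × K n) ≃ₗ[ℂ] V n :=
    (LinearEquiv.prodCongr f.symm g.symm).trans (Submodule.prodEquivOfIsCompl _ _ hc)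
  let e : Split n := e₀.symm.toContinuousLinearEquiv
  refine ⟨e, ?_⟩
  ext w
  constructor
  · rintro ⟨k, rfl⟩
    have : graphMap e 0 k = (f.symm k : V n) := by
      rw [graphMap_apply]
      change (Submodule.prodEquivOfIsCompl _ _ hc) (f.symm k, g.symm 0) = _
      simp
    change graphMap e 0 k ∈ _
    rw [this]
    exact (f.symm k).2
  · intro hw
    refine ⟨f ⟨w, hw⟩, ?_⟩
    change graphMap e 0 (f ⟨w, hw⟩) = w
    rw [graphMap_apply]
    change (Submodule.prodEquivOfIsCompl _ _ hc) (f.symm (f ⟨w, hw⟩), g.symm 0) = _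
    simp

/-- A splitting whose chart is centred at `z`. -/
def splitAt (z : Gr n) : Split n := (exists_split z).choose

theorem mem_splitAt (z : Gr n) : z ∈ (grChart (splitAt z)).source :=
  ⟨0, (exists_split z).choose_spec⟩

/-- The atlas of the Grassmannian. -/
def grCore (n : ℕ) : ChartedSpaceCore (M n) (Gr n) where
  atlas := Set.range grChart
  chartAt z := grChart (splitAt z)
  mem_chart_source := mem_splitAt
  chart_mem_atlas z := ⟨_, rfl⟩
  open_source := by
    rintro _ _ ⟨e, rfl⟩ ⟨e', rfl⟩; exact isOpen_trans_source e e'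
  continuousOn_toFun := by
    rintro _ _ ⟨e, rfl⟩ ⟨e', rfl⟩; exact (contDiffOn_trans e e').continuousOn

instance : TopologicalSpace (Gr n) := (grCore n).toTopologicalSpace

instance : ChartedSpace (M n) (Gr n) := (grCore n).toChartedSpace

theorem mem_atlas_iff (f : OpenPartialHomeomorph (Gr n) (M n)) :
    f ∈ atlas (M n) (Gr n) ↔ ∃ e, f = (grCore n).openPartialHomeomorph (grChart e) ⟨e, rfl⟩ := by
  change f ∈ ⋃ (e : PartialEquiv (Gr n) (M n)) (he : e ∈ (grCore n).atlas),
    {(grCore n).openPartialHomeomorph e he} ↔ _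
  simp only [mem_iUnion, mem_singleton_iff]
  constructor
  · rintro ⟨_, ⟨e, rfl⟩, h⟩; exact ⟨e, h⟩
  · rintro ⟨e, h⟩; exact ⟨_, ⟨e, rfl⟩, h⟩

/-- The Grassmannian is a complex analytic manifold, modelled on the `n × n` matrices. -/
instance : IsManifold 𝓘(ℂ, M n) ω (Gr n) := by
  refine isManifold_of_contDiffOn _ _ _ ?_
  intro f f' hf hf'
  obtain ⟨e, rfl⟩ := (mem_atlas_iff f).1 hf
  obtain ⟨e', rfl⟩ := (mem_atlas_iff f').1 hf'
  exact (contDiffOn_trans e e').mono fun A hA => hA.1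

theorem isOpen_source (e : Split n) : IsOpen (grChart e).source :=
  (grCore n).open_source' ⟨e, rfl⟩

theorem contMDiffOn_grChart (e : Split n) :
    ContMDiffOn 𝓘(ℂ, M n) 𝓘(ℂ, M n) ω (grChart e) (grChart e).source :=
  contMDiffOn_of_mem_maximalAtlas (e := (grCore n).openPartialHomeomorph (grChart e) ⟨e, rfl⟩)
    (IsManifold.subset_maximalAtlas ((mem_atlas_iff _).2 ⟨e, rfl⟩))

/-! ### Vector bundles over the Grassmannian given by local frames -/

/-- Holomorphic local trivializations, one over the domain of each chart, of a family of vector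
spaces over the Grassmannian. The transition maps are analytic functions of the chart
coordinate. -/
structure Frames (F : Type) [NormedAddCommGroup F] [NormedSpace ℂ F] (E : Gr n → Type)
    [∀ z, AddCommGroup (E z)] [∀ z, Module ℂ (E z)] [∀ z, TopologicalSpace (E z)] where
  triv : ∀ (e : Split n) (z : Gr n), z ∈ (grChart e).source → (E z ≃ₗ[ℂ] F)
  isInducing : ∀ (e : Split n) (z : Gr n) (h : z ∈ (grChart e).source), IsInducing (triv e z h)
  change : Split n → Split n → M n → F →L[ℂ] F
  contDiff_change : ∀ e e', ContDiff ℂ ω (change e e')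
  change_apply : ∀ (e e' : Split n) (z : Gr n) (h : z ∈ (grChart e).source)
    (h' : z ∈ (grChart e').source) (v : F),
    change e e' (grChart e z) v = triv e' z h' ((triv e z h).symm v)

namespace Frames

variable {F : Type} [NormedAddCommGroup F] [NormedSpace ℂ F] {E : Gr n → Type}
    [∀ z, AddCommGroup (E z)] [∀ z, Module ℂ (E z)] [∀ z, TopologicalSpace (E z)]

open Classical in
/-- The trivialization over the domain of the chart of `e`. -/
def pretriv (a : Frames F E) (e : Split n) : Pretrivialization F (π F E) where
  toFun x := (x.1, if h : x.1 ∈ (grChart e).source then a.triv e x.1 h x.2 else 0)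
  invFun y := ⟨y.1, if h : y.1 ∈ (grChart e).source then (a.triv e y.1 h).symm y.2 else 0⟩
  source := π F E ⁻¹' (grChart e).source
  target := (grChart e).source ×ˢ univ
  map_source' x hx := ⟨hx, mem_univ _⟩
  map_target' y hy := hy.1
  left_inv' := by
    rintro ⟨z, v⟩ (hz : z ∈ (grChart e).source)
    simp [hz]
  right_inv' := by
    rintro ⟨z, v⟩ ⟨hz : z ∈ (grChart e).source, -⟩
    simp [hz]
  open_target := (isOpen_source e).prod isOpen_univ
  baseSet := (grChart e).source
  open_baseSet := isOpen_source e
  source_eq := rfl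
  target_eq := rfl
  proj_toFun _ _ := rfl

theorem pretriv_apply (a : Frames F E) (e : Split n) (z : Gr n) (h : z ∈ (grChart e).source)
    (v : E z) : a.pretriv e ⟨z, v⟩ = (z, a.triv e z h v) := by
  change (z, _) = _
  simp [h]

theorem pretriv_symm_apply (a : Frames F E) (e : Split n) (z : Gr n)
    (h : z ∈ (grChart e).source) (v : F) :
    (a.pretriv e).symm z v = (a.triv e z h).symm v := by
  have h' : z ∈ (a.pretriv e).baseSet := h
  rw [Pretrivialization.symm_apply _ h']
  apply (a.triv e z h).injective
  rw [LinearEquiv.apply_symm_apply]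
  have := (a.pretriv e).apply_mk_symm h' v
  rw [Pretrivialization.symm_apply _ h', pretriv_apply a e z h] at this
  exact (Prod.ext_iff.1 this).2

theorem change_eq (a : Frames F E) (e e' : Split n) (z : Gr n)
    (h : z ∈ (grChart e).source ∩ (grChart e').source) (v : F) :
    a.change e e' (grChart e z) v = (a.pretriv e' ⟨z, (a.pretriv e).symm z v⟩).2 := by
  rw [a.pretriv_symm_apply e z h.1, a.pretriv_apply e' z h.2, a.change_apply e e' z h.1 h.2]

theorem contMDiffOn_change (a : Frames F E) (e e' : Split n) :
    ContMDiffOn 𝓘(ℂ, M n) 𝓘(ℂ, F →L[ℂ] F) ω (fun z => a.change e e' (grChart e z))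
      ((grChart e).source ∩ (grChart e').source) :=
  (a.contDiff_change e e').contMDiff.comp_contMDiffOn
    ((contMDiffOn_grChart e).mono inter_subset_left)

/-- The vector bundle defined by the local trivializations. -/
def prebundle (a : Frames F E) : VectorPrebundle ℂ F E where
  pretrivializationAtlas := Set.range a.pretriv
  pretrivialization_linear' := by
    rintro _ ⟨e, rfl⟩
    refine ⟨fun z hz => ⟨fun v w => ?_, fun c v => ?_⟩⟩
    all_goals
      have hz' : z ∈ (grChart e).source := hz
      simp [a.pretriv_apply e z hz']
  pretrivializationAt z := a.pretriv (splitAt z)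
  mem_base_pretrivializationAt := mem_splitAt
  pretrivialization_mem_atlas z := ⟨_, rfl⟩
  exists_coordChange := by
    rintro _ ⟨e, rfl⟩ _ ⟨e', rfl⟩
    exact ⟨_, (a.contMDiffOn_change e e').continuousOn, a.change_eq e e'⟩
  totalSpaceMk_isInducing z := by
    have h := mem_splitAt z
    have : (a.pretriv (splitAt z) ∘ TotalSpace.mk z : E z → Gr n × F) =
        (fun v => (z, v)) ∘ a.triv (splitAt z) z h := by
      ext1 v
      exact a.pretriv_apply _ z h v
    rw [this]
    exact (isInducing_prodMkRight z).comp (a.isInducing _ z h)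

theorem isContMDiff (a : Frames F E) : a.prebundle.IsContMDiff 𝓘(ℂ, M n) ω where
  exists_contMDiffCoordChange := by
    rintro _ ⟨e, rfl⟩ _ ⟨e', rfl⟩
    exact ⟨_, a.contMDiffOn_change e e', a.change_eq e e'⟩

end Frames

/-! ### The bundles `E`, `E^⊥`, `E ⊗ E^⊥` and `N` -/

/-- The fibre `E_z = z` of the tautological bundle. -/
abbrev EFib (z : Gr n) : Type := z.space

instance (z : Gr n) : AddCommGroup (EFib z) := z.space.addCommGroup
instance (z : Gr n) : Module ℂ (EFib z) := z.space.module

/-- The annihilator of `z` in the dual of `ℂ²ⁿ`. -/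
def annih (z : Gr n) : Submodule ℂ (V n →L[ℂ] ℂ) where
  carrier := {φ | ∀ w ∈ z.space, φ w = 0}
  zero_mem' := fun _ _ => rfl
  add_mem' := fun h h' w hw => by simp [h w hw, h' w hw]
  smul_mem' := fun c φ h w hw => by simp [h w hw]

/-- The fibre of `E^⊥`: the functionals on `ℂ²ⁿ` vanishing on `z`. -/
abbrev PFib (z : Gr n) : Type := annih z

instance (z : Gr n) : AddCommGroup (PFib z) := (annih z).addCommGroup
instance (z : Gr n) : Module ℂ (PFib z) := (annih z).module

/-- The fibre of the tensor product bundle `E ⊗ E^⊥`. -/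
def EPFib (z : Gr n) : Type := EFib z ⊗[ℂ] PFib z

instance (z : Gr n) : AddCommGroup (EPFib z) := inferInstanceAs (AddCommGroup (EFib z ⊗[ℂ] PFib z))
instance (z : Gr n) : Module ℂ (EPFib z) := inferInstanceAs (Module ℂ (EFib z ⊗[ℂ] PFib z))
/-- The canonical topology of a finite dimensional complex vector space. -/
instance (z : Gr n) : TopologicalSpace (EPFib z) := moduleTopology ℂ (EPFib z)
instance (z : Gr n) : IsModuleTopology ℂ (EPFib z) := ⟨rfl⟩

/-- The linear maps `Z` of `ℂ²ⁿ` with `Im Z ⊆ z ⊆ Ker Z`. -/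
def nilp (z : Gr n) : Submodule ℂ (gl n) where
  carrier := {Z | LinearMap.range (Z : V n →ₗ[ℂ] V n) ≤ z.space ∧
    z.space ≤ LinearMap.ker (Z : V n →ₗ[ℂ] V n)}
  zero_mem' := ⟨by rintro _ ⟨v, rfl⟩; exact z.space.zero_mem, fun _ _ => rfl⟩
  add_mem' := by
    rintro Z Z' ⟨h1, h2⟩ ⟨h1', h2'⟩
    constructor
    · rintro _ ⟨v, rfl⟩
      exact z.space.add_mem (h1 ⟨v, rfl⟩) (h1' ⟨v, rfl⟩)
    · intro w hw
      have a : Z w = 0 := h2 hw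
      have b : Z' w = 0 := h2' hw
      change Z w + Z' w = 0
      rw [a, b, add_zero]
  smul_mem' := by
    rintro c Z ⟨h1, h2⟩
    constructor
    · rintro _ ⟨v, rfl⟩
      exact z.space.smul_mem c (h1 ⟨v, rfl⟩)
    · intro w hw
      have a : Z w = 0 := h2 hw
      change c • Z w = 0
      rw [a, smul_zero]

/-- The fibre `N_z` of the bundle of nilpotent elements. -/
abbrev NFib (z : Gr n) : Type := nilp z

instance (z : Gr n) : AddCommGroup (NFib z) := (nilp z).addCommGroup
instance (z : Gr n) : Module ℂ (NFib z) := (nilp z).module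

/-- The map `w ↦ (e w)₂ - A (e w)₁`, whose kernel is the graph of `A`. -/
def coker (e : Split n) (A : M n) : V n →L[ℂ] K n :=
  (ContinuousLinearMap.snd ℂ (K n) (K n) - A ∘L ContinuousLinearMap.fst ℂ (K n) (K n)) ∘L
    (e : V n →L[ℂ] K n × K n)

theorem coker_apply (e : Split n) (A : M n) (w : V n) : coker e A w = (e w).2 - A (e w).1 := rfl

theorem contDiff_coker (e : Split n) : ContDiff ℂ ω (coker e) := by
  unfold coker
  fun_prop

/-- The inclusion `y ↦ e⁻¹(0, y)` of the second summand of a splitting. -/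
def inr (e : Split n) : K n →L[ℂ] V n :=
  (e.symm : K n × K n →L[ℂ] V n) ∘L ContinuousLinearMap.inr ℂ (K n) (K n)

theorem inr_apply (e : Split n) (y : K n) : inr e y = e.symm (0, y) := rfl

theorem sub_inr_coker_mem {e : Split n} {z : Gr n} (h : z ∈ (grChart e).source) (w : V n) :
    w - inr e (coker e (grChart e z) w) ∈ z.space := by
  rw [mem_iff_of_mem_source h]
  simp [inr_apply, coker_apply]

theorem coker_eq_zero {e : Split n} {z : Gr n} (h : z ∈ (grChart e).source) {w : V n}
    (hw : w ∈ z.space) : coker e (grChart e z) w = 0 := by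
  rw [coker_apply, sub_eq_zero]
  exact (mem_iff_of_mem_source h).1 hw

theorem coker_inr (e : Split n) (A : M n) (y : K n) : coker e A (inr e y) = y := by
  simp [inr_apply, coker_apply]

theorem graphMap_mem {e : Split n} {z : Gr n} (h : z ∈ (grChart e).source) (k : K n) :
    graphMap e (grChart e z) k ∈ z.space := by
  rw [mem_iff_of_mem_source h]; simp [graphMap_apply]

theorem graphMap_fst {e : Split n} {z : Gr n} (h : z ∈ (grChart e).source) {w : V n}
    (hw : w ∈ z.space) : graphMap e (grChart e z) (e w).1 = w := by
  rw [graphMap_apply, ← (mem_iff_of_mem_source h).1 hw]; simp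

/-- The trivialization `w ↦ (e w)₁` of the tautological bundle over a chart domain. -/
def trivE (e : Split n) (z : Gr n) (h : z ∈ (grChart e).source) : EFib z ≃ₗ[ℂ] K n where
  toFun w := (e w.1).1
  map_add' w w' := by simp
  map_smul' c w := by simp
  invFun k := ⟨graphMap e (grChart e z) k, graphMap_mem h k⟩
  left_inv w := Subtype.ext (graphMap_fst h w.2)
  right_inv k := by simp [graphMap_apply]

/-- The trivialization of `E^⊥` over a chart domain: a functional `φ` vanishing on `z` is sent to
the coordinates of the functional `y ↦ φ (e⁻¹(0, y))` on `ℂⁿ`. -/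
def trivP (e : Split n) (z : Gr n) (h : z ∈ (grChart e).source) : PFib z ≃ₗ[ℂ] K n where
  toFun φ := fun j => φ.1 (inr e (Pi.single j 1))
  map_add' φ ψ := rfl
  map_smul' c φ := rfl
  invFun c := ⟨(∑ j, c j • ContinuousLinearMap.proj j) ∘L coker e (grChart e z), fun w hw => by
    rw [ContinuousLinearMap.comp_apply, coker_eq_zero h hw, map_zero]⟩
  left_inv φ := by
    ext1
    ext1 w
    have h1 := φ.2 _ (sub_inr_coker_mem h w)
    rw [map_sub, sub_eq_zero] at h1
    rw [h1]
    have h2 := LinearMap.pi_apply_eq_sum_univ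
      ((φ.1 ∘L inr e : K n →L[ℂ] ℂ) : K n →ₗ[ℂ] ℂ) (coker e (grChart e z) w)
    change φ.1 (inr e (coker e (grChart e z) w)) = _ at h2
    rw [h2]
    simp only [ContinuousLinearMap.comp_apply, sum_apply,
      smul_apply, ContinuousLinearMap.proj_apply, smul_eq_mul]
    refine Finset.sum_congr rfl fun j _ => ?_
    rw [mul_comm]
    have h3 : (Pi.single j 1 : K n) = fun i => if j = i then 1 else 0 := by
      ext i
      simp [Pi.single_apply, eq_comm]
    rw [h3]
    rfl
  right_inv c := by
    ext j
    simp [coker_inr, Pi.single_apply]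

/-- The tensor product of the trivializations of `E` and of `E^⊥`. -/
def trivEP (e : Split n) (z : Gr n) (h : z ∈ (grChart e).source) :
    EPFib z ≃ₗ[ℂ] (Fin n × Fin n → ℂ) :=
  (TensorProduct.congr (trivE e z h) (trivP e z h)).trans
    ((Pi.basisFun ℂ (Fin n)).tensorProduct (Pi.basisFun ℂ (Fin n))).equivFun

/-- The trivialization `Z ↦ (y ↦ (e (Z (e⁻¹(0, y))))₁)` of `N` over a chart domain. -/
def trivN (e : Split n) (z : Gr n) (h : z ∈ (grChart e).source) : NFib z ≃ₗ[ℂ] M n where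
  toFun Z := ContinuousLinearMap.fst ℂ (K n) (K n) ∘L (e : V n →L[ℂ] K n × K n) ∘L Z.1 ∘L inr e
  map_add' Z Z' := by ext; simp
  map_smul' c Z := by ext; simp
  invFun Y := ⟨graphMap e (grChart e z) ∘L Y ∘L coker e (grChart e z), by
    constructor
    · rintro _ ⟨v, rfl⟩
      exact graphMap_mem h _
    · intro w hw
      change graphMap e (grChart e z) (Y (coker e (grChart e z) w)) = 0
      rw [coker_eq_zero h hw, map_zero, map_zero]⟩
  left_inv Z := by
    ext1
    refine ContinuousLinearMap.ext fun w => ?_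
    change graphMap e (grChart e z) (e (Z.1 (inr e (coker e (grChart e z) w)))).1 = Z.1 w
    have h0 : ∀ v, graphMap e (grChart e z) (e (Z.1 v)).1 = Z.1 v := fun v =>
      graphMap_fst h (Z.2.1 ⟨v, rfl⟩)
    rw [h0]
    have h1 : Z.1 (w - inr e (coker e (grChart e z) w)) = 0 := Z.2.2 (sub_inr_coker_mem h w)
    rw [map_sub, sub_eq_zero] at h1
    exact h1.symm
  right_inv Y := by
    refine ContinuousLinearMap.ext fun y => ?_
    change (e (graphMap e (grChart e z) (Y (coker e (grChart e z) (inr e y))))).1 = Y y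
    rw [coker_inr, graphMap_apply]
    simp

theorem isInducing_of_linearEquiv {E F : Type} [AddCommGroup E] [Module ℂ E] [TopologicalSpace E]
    [IsTopologicalAddGroup E] [ContinuousSMul ℂ E] [T2Space E] [FiniteDimensional ℂ E]
    [NormedAddCommGroup F] [NormedSpace ℂ F] (f : E ≃ₗ[ℂ] F) : IsInducing f :=
  f.toContinuousLinearEquiv.toHomeomorph.isInducing

theorem isInducing_of_linearEquiv' {E F : Type} [AddCommGroup E] [Module ℂ E] [TopologicalSpace E]
    [IsModuleTopology ℂ E] [NormedAddCommGroup F] [NormedSpace ℂ F] [FiniteDimensional ℂ F]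
    (f : E ≃ₗ[ℂ] F) : IsInducing f := by
  have : IsTopologicalAddGroup E := IsModuleTopology.topologicalAddGroup ℂ E
  have : ContinuousAdd E := IsModuleTopology.toContinuousAdd ℂ E
  let g : E ≃ₜ F :=
    { f.toEquiv with
      continuous_toFun := IsModuleTopology.continuous_of_linearMap (f : E →ₗ[ℂ] F)
      continuous_invFun := LinearMap.continuous_of_finiteDimensional (f.symm : F →ₗ[ℂ] E) }
  exact g.isInducing

/-- The transpose of a matrix. -/
def transp (n : ℕ) : M n →ₗ[ℂ] M n where
  toFun B := ContinuousLinearMap.pi fun j => ∑ i, B (Pi.single j 1) i • ContinuousLinearMap.proj i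
  map_add' B B' := by ext; simp [add_mul, Finset.sum_add_distrib]
  map_smul' c B := by ext; simp [Finset.mul_sum, mul_assoc]

/-- The block of the transition maps which acts on the annihilators. -/
def blockD (e e' : Split n) (A : M n) : M n := coker e A ∘L inr e'

theorem contDiff_blockD (e e' : Split n) : ContDiff ℂ ω (blockD e e') := by
  unfold blockD
  have := contDiff_coker e
  fun_prop

/-- The transition maps of the bundle of annihilators. -/
def changeP (e e' : Split n) (A : M n) : M n :=
  LinearMap.toContinuousLinearMap (transp n) (blockD e e' A)

theorem contDiff_changeP (e e' : Split n) : ContDiff ℂ ω (changeP e e') :=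
  (LinearMap.toContinuousLinearMap (transp n)).contDiff.comp (contDiff_blockD e e')

theorem changeP_apply (e e' : Split n) (z : Gr n) (h : z ∈ (grChart e).source)
    (h' : z ∈ (grChart e').source) (v : K n) :
    changeP e e' (grChart e z) v = trivP e' z h' ((trivP e z h).symm v) := by
  ext j
  change (∑ i, blockD e e' (grChart e z) (Pi.single j 1) i •
    (ContinuousLinearMap.proj i : K n →L[ℂ] ℂ)) v =
    (∑ i, v i • (ContinuousLinearMap.proj i : K n →L[ℂ] ℂ)) (coker e (grChart e z)
      (inr e' (Pi.single j 1)))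
  simp [blockD, mul_comm]

/-- The tensor product of two matrices. -/
def kron (n : ℕ) :
    M n →L[ℂ] M n →L[ℂ] ((Fin n × Fin n → ℂ) →L[ℂ] (Fin n × Fin n → ℂ)) :=
  LinearMap.toContinuousBilinearMap <| LinearMap.mk₂ ℂ
    (fun B C => LinearMap.toContinuousLinearMap
      ((((Pi.basisFun ℂ (Fin n)).tensorProduct (Pi.basisFun ℂ (Fin n))).equivFun : _ →ₗ[ℂ] _) ∘ₗ
        TensorProduct.map (B : K n →ₗ[ℂ] K n) (C : K n →ₗ[ℂ] K n) ∘ₗ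
        (((Pi.basisFun ℂ (Fin n)).tensorProduct (Pi.basisFun ℂ (Fin n))).equivFun.symm :
          _ →ₗ[ℂ] _)))
    (by intros; simp [TensorProduct.map_add_left, LinearMap.add_comp, LinearMap.comp_add])
    (by intros; simp [TensorProduct.map_smul_left, LinearMap.smul_comp, LinearMap.comp_smul])
    (by intros; simp [TensorProduct.map_add_right, LinearMap.add_comp, LinearMap.comp_add])
    (by intros; simp [TensorProduct.map_smul_right, LinearMap.smul_comp, LinearMap.comp_smul])

theorem tensor_change {E P : Type} [AddCommGroup E] [Module ℂ E] [AddCommGroup P] [Module ℂ P]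
    (f f' : E ≃ₗ[ℂ] K n) (g g' : P ≃ₗ[ℂ] K n) {B C : M n}
    (hB : ∀ v, B v = f' (f.symm v)) (hC : ∀ v, C v = g' (g.symm v)) (v : Fin n × Fin n → ℂ) :
    kron n B C v =
      ((TensorProduct.congr f' g').trans
        ((Pi.basisFun ℂ (Fin n)).tensorProduct (Pi.basisFun ℂ (Fin n))).equivFun)
      (((TensorProduct.congr f g).trans
        ((Pi.basisFun ℂ (Fin n)).tensorProduct (Pi.basisFun ℂ (Fin n))).equivFun).symm v) := by
  have h1 : (B : K n →ₗ[ℂ] K n) = (f' : E →ₗ[ℂ] K n) ∘ₗ (f.symm : K n →ₗ[ℂ] E) :=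
    LinearMap.ext hB
  have h2 : (C : K n →ₗ[ℂ] K n) = (g' : P →ₗ[ℂ] K n) ∘ₗ (g.symm : K n →ₗ[ℂ] P) :=
    LinearMap.ext hC
  change ((Pi.basisFun ℂ (Fin n)).tensorProduct (Pi.basisFun ℂ (Fin n))).equivFun
    (TensorProduct.map (B : K n →ₗ[ℂ] K n) (C : K n →ₗ[ℂ] K n)
      (((Pi.basisFun ℂ (Fin n)).tensorProduct (Pi.basisFun ℂ (Fin n))).equivFun.symm v)) = _
  rw [h1, h2, TensorProduct.map_comp]
  rfl

/-- The tautological bundle `E`. -/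
def framesE (n : ℕ) : Frames (K n) (EFib (n := n)) where
  triv := trivE
  isInducing e z h := isInducing_of_linearEquiv (trivE e z h)
  change := blockA
  contDiff_change := contDiff_blockA
  change_apply _ _ _ _ _ _ := rfl

/-- The bundle `E^⊥`. -/
def framesP (n : ℕ) : Frames (K n) (PFib (n := n)) where
  triv := trivP
  isInducing e z h := isInducing_of_linearEquiv (trivP e z h)
  change := changeP
  contDiff_change := contDiff_changeP
  change_apply := changeP_apply

/-- The tensor product bundle `E ⊗ E^⊥`. -/
def framesEP (n : ℕ) : Frames (Fin n × Fin n → ℂ) (EPFib (n := n)) where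
  triv := trivEP
  isInducing e z h := isInducing_of_linearEquiv' (trivEP e z h)
  change e e' A := kron n (blockA e e' A) (changeP e e' A)
  contDiff_change e e' := by
    have h1 := contDiff_blockA e e'
    have h2 := contDiff_changeP e e'
    fun_prop
  change_apply e e' z h h' v := by
    exact tensor_change (trivE e z h) (trivE e' z h') (trivP e z h) (trivP e' z h')
      (fun _ => rfl) (changeP_apply e e' z h h') v

/-- The bundle `N` of nilpotent elements. -/
def framesN (n : ℕ) : Frames (M n) (NFib (n := n)) where
  triv := trivN
  isInducing e z h := isInducing_of_linearEquiv (trivN e z h)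
  change e e' A :=
    (ContinuousLinearMap.compL ℂ (K n) (K n) (K n) (blockA e e' A)) ∘L
      ((ContinuousLinearMap.compL ℂ (K n) (K n) (K n)).flip (blockD e e' A))
  contDiff_change e e' := by
    have h1 := contDiff_blockA e e'
    have h2 := contDiff_blockD e e'
    fun_prop
  change_apply e e' z h h' Y := rfl

instance : TopologicalSpace (TotalSpace (K n) (EFib (n := n))) :=
  (framesE n).prebundle.totalSpaceTopology
instance : FiberBundle (K n) (EFib (n := n)) := (framesE n).prebundle.toFiberBundle
instance : VectorBundle ℂ (K n) (EFib (n := n)) := (framesE n).prebundle.toVectorBundle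
instance : ContMDiffVectorBundle ω (K n) (EFib (n := n)) 𝓘(ℂ, M n) :=
  have := (framesE n).isContMDiff
  (framesE n).prebundle.contMDiffVectorBundle (n := ω) (IB := 𝓘(ℂ, M n))

instance : TopologicalSpace (TotalSpace (K n) (PFib (n := n))) :=
  (framesP n).prebundle.totalSpaceTopology
instance : FiberBundle (K n) (PFib (n := n)) := (framesP n).prebundle.toFiberBundle
instance : VectorBundle ℂ (K n) (PFib (n := n)) := (framesP n).prebundle.toVectorBundle
instance : ContMDiffVectorBundle ω (K n) (PFib (n := n)) 𝓘(ℂ, M n) :=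
  have := (framesP n).isContMDiff
  (framesP n).prebundle.contMDiffVectorBundle (n := ω) (IB := 𝓘(ℂ, M n))

instance : TopologicalSpace (TotalSpace (Fin n × Fin n → ℂ) (EPFib (n := n))) :=
  (framesEP n).prebundle.totalSpaceTopology
instance : FiberBundle (Fin n × Fin n → ℂ) (EPFib (n := n)) := (framesEP n).prebundle.toFiberBundle
instance : VectorBundle ℂ (Fin n × Fin n → ℂ) (EPFib (n := n)) :=
  (framesEP n).prebundle.toVectorBundle
instance : ContMDiffVectorBundle ω (Fin n × Fin n → ℂ) (EPFib (n := n)) 𝓘(ℂ, M n) :=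
  have := (framesEP n).isContMDiff
  (framesEP n).prebundle.contMDiffVectorBundle (n := ω) (IB := 𝓘(ℂ, M n))

instance : TopologicalSpace (TotalSpace (M n) (NFib (n := n))) :=
  (framesN n).prebundle.totalSpaceTopology
instance : FiberBundle (M n) (NFib (n := n)) := (framesN n).prebundle.toFiberBundle
instance : VectorBundle ℂ (M n) (NFib (n := n)) := (framesN n).prebundle.toVectorBundle
instance : ContMDiffVectorBundle ω (M n) (NFib (n := n)) 𝓘(ℂ, M n) :=
  have := (framesN n).isContMDiff
  (framesN n).prebundle.contMDiffVectorBundle (n := ω) (IB := 𝓘(ℂ, M n))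

/-! ### The cotangent bundle -/

/-- The fibre of the holomorphic cotangent bundle of the Grassmannian, which is the bundle of
linear maps from the tangent bundle to the trivial line bundle. -/
abbrev CotFib (z : Gr n) : Type :=
  TangentSpace 𝓘(ℂ, M n) z →L[ℂ] Bundle.Trivial (Gr n) ℂ z

/-! ### The actions of `GL(2n, ℂ)` -/

/-- The map `w ↦ g w` from `z` to `g z`. -/
def actE (g : GL2 n) (z : Gr n) : EFib z →ₗ[ℂ] EFib (g • z) where
  toFun w := ⟨g w.1, mem_smul_of_mem g w.2⟩
  map_add' w w' := Subtype.ext (map_add g w.1 w'.1)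
  map_smul' c w := Subtype.ext (map_smul g c w.1)

/-- The map `φ ↦ φ ∘ g⁻¹` from the annihilator of `z` to that of `g z`. -/
def actP (g : GL2 n) (z : Gr n) : PFib z →ₗ[ℂ] PFib (g • z) where
  toFun φ := ⟨φ.1 ∘L (g.symm : V n →L[ℂ] V n), fun _ hw => φ.2 _ (inv_mem_of_mem_smul g hw)⟩
  map_add' _ _ := rfl
  map_smul' _ _ := rfl

/-- The action on `E ⊗ E^⊥`. -/
def actEP (g : GL2 n) (z : Gr n) : EPFib z →ₗ[ℂ] EPFib (g • z) :=
  TensorProduct.map (actE g z) (actP g z)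

/-- The map `Z ↦ g Z g⁻¹` from `N_z` to `N_{g z}`. -/
def actN (g : GL2 n) (z : Gr n) : NFib z →ₗ[ℂ] NFib (g • z) where
  toFun Z := ⟨(g : V n →L[ℂ] V n) ∘L Z.1 ∘L (g.symm : V n →L[ℂ] V n), by
    constructor
    · rintro _ ⟨v, rfl⟩
      exact mem_smul_of_mem g (Z.2.1 ⟨g.symm v, rfl⟩)
    · intro w hw
      have h : Z.1 (g.symm w) = 0 := Z.2.2 (inv_mem_of_mem_smul g hw)
      change g (Z.1 (g.symm w)) = 0
      rw [h, map_zero]⟩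
  map_add' Z Z' := by ext; simp
  map_smul' c Z := by ext; simp

/-- The cotangent lift of `σ_g : z ↦ g z`, that is `α ↦ α ∘ (dσ_g(z))⁻¹`. -/
def actCot (g : GL2 n) (z : Gr n) : CotFib z →ₗ[ℂ] CotFib (g • z) where
  toFun α := α ∘L (mfderiv 𝓘(ℂ, M n) 𝓘(ℂ, M n) (fun z : Gr n => g • z) z).inverse
  map_add' _ _ := rfl
  map_smul' _ _ := rfl

section Bundles

variable {F : Type} {E : Gr n → Type} [∀ z, AddCommGroup (E z)] [∀ z, Module ℂ (E z)]

/-- The map of the total space of a bundle over `σ_g` given by linear maps of the fibres. -/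
def totalAct (F : Type) (ρ : ∀ (g : GL2 n) (z : Gr n), E z →ₗ[ℂ] E (g • z)) (g : GL2 n)
    (x : TotalSpace F E) : TotalSpace F E :=
  ⟨g • x.1, ρ g x.1 x.2⟩

/-- The orbit of a point of the total space. -/
def orbit (ρ : ∀ (g : GL2 n) (z : Gr n), E z →ₗ[ℂ] E (g • z)) (x : TotalSpace F E) :
    Set (TotalSpace F E) :=
  Set.range fun g => totalAct F ρ g x

/-- The total space is the disjoint union of the sets `S 0, …, S n`, and each of them is an
orbit. -/
def SplitsIntoOrbits (ρ : ∀ (g : GL2 n) (z : Gr n), E z →ₗ[ℂ] E (g • z))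
    (S : ℕ → Set (TotalSpace F E)) : Prop :=
  (∀ x, ∃! k, k ≤ n ∧ x ∈ S k) ∧ ∀ k ≤ n, ∃ x, S k = orbit ρ x

variable [∀ z, TopologicalSpace (E z)]

/-- The maps `ρ g` define an action of `GL(2n, ℂ)` on a holomorphic vector bundle by holomorphic
vector bundle automorphisms over the maps `σ_g`. -/
structure IsVectorBundleAction (F : Type) [NormedAddCommGroup F] [NormedSpace ℂ F]
    [TopologicalSpace (TotalSpace F E)] [FiberBundle F E] [VectorBundle ℂ F E]
    (ρ : ∀ (g : GL2 n) (z : Gr n), E z →ₗ[ℂ] E (g • z)) : Prop where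
  one (x : TotalSpace F E) : totalAct F ρ 1 x = x
  mul (g h : GL2 n) (x : TotalSpace F E) : totalAct F ρ (g * h) x = totalAct F ρ g (totalAct F ρ h x)
  holomorphic (g : GL2 n) : ContMDiff (𝓘(ℂ, M n).prod 𝓘(ℂ, F)) (𝓘(ℂ, M n).prod 𝓘(ℂ, F)) ω
    (totalAct F ρ g)

variable {E' : Gr n → Type}
  [∀ z, AddCommGroup (E' z)] [∀ z, Module ℂ (E' z)] [∀ z, TopologicalSpace (E' z)]

/-- The map of total spaces given by linear isomorphisms of the fibres. -/
def totalMap (F F' : Type) (f : ∀ z, E z ≃ₗ[ℂ] E' z) (x : TotalSpace F E) : TotalSpace F' E' :=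
  ⟨x.1, f x.1 x.2⟩

/-- The linear isomorphisms `f z` of the fibres form an isomorphism of holomorphic vector
bundles: the resulting map of total spaces is biholomorphic. -/
structure IsVectorBundleIso (F F' : Type) [NormedAddCommGroup F] [NormedSpace ℂ F]
    [TopologicalSpace (TotalSpace F E)] [FiberBundle F E] [VectorBundle ℂ F E]
    [NormedAddCommGroup F'] [NormedSpace ℂ F']
    [TopologicalSpace (TotalSpace F' E')] [FiberBundle F' E'] [VectorBundle ℂ F' E']
    (f : ∀ z, E z ≃ₗ[ℂ] E' z) : Prop where
  holomorphic : ContMDiff (𝓘(ℂ, M n).prod 𝓘(ℂ, F)) (𝓘(ℂ, M n).prod 𝓘(ℂ, F')) ω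
    (totalMap F F' f)
  holomorphic_symm : ContMDiff (𝓘(ℂ, M n).prod 𝓘(ℂ, F')) (𝓘(ℂ, M n).prod 𝓘(ℂ, F)) ω
    (totalMap F' F fun z => (f z).symm)

end Bundles

/-! ### The explicit form of the isomorphisms -/

open Classical in
/-- The chart `φ_p(z) = q_z - p` attached to an idempotent `p`, as a map into `gl(2n, ℂ)`: if
`ℂ²ⁿ = z ⊕ Ker p`, then `q_z` is the projection onto `z` along `Ker p`. -/
def phi (p : gl n) (z : Gr n) : gl n :=
  if h : IsCompl z.space (LinearMap.ker (p : V n →ₗ[ℂ] V n)) then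
    LinearMap.toContinuousLinearMap (Submodule.projection _ _ h) - p
  else 0

/-- The element `v ↦ φ(v) w` of `gl(2n, ℂ)`. -/
def rankOne (w : V n) (φ : V n →L[ℂ] ℂ) : gl n := φ.smulRight w

/-- The trace form `(Z₁, Z₂) ↦ Tr (Z₁ Z₂)` on `gl(2n, ℂ)`. -/
def traceForm (Z₁ Z₂ : gl n) : ℂ := LinearMap.trace ℂ (V n) ((Z₁ ∘L Z₂ : gl n) : V n →ₗ[ℂ] V n)

/-- The set `N^k` of the points `(Z, z)` of `N` with `rank Z = k`. -/
def NOrbit (n k : ℕ) : Set (TotalSpace (M n) (NFib (n := n))) :=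
  {x | Module.finrank ℂ (LinearMap.range (x.2.1 : V n →ₗ[ℂ] V n)) = k}

end GrBundles
end

open GrBundles

/-
Near `z` the Grassmannian is parametrised by graphs of matrices `A : ℂⁿ → ℂⁿ`, and in the frame of
such a chart a nilpotent `Z ∈ N_z` is a matrix `Y`, an element of `E_z ⊗ E_z^⊥` is the array of the
entries of `Y`, and a cotangent vector is a linear form `X ↦ Tr (Y X)`. So both isomorphisms have
constant coefficients in charts, and they do not depend on the chart because a change of chart
turns `Y` into `a Y d` and `X` into `d⁻¹ X a⁻¹`.

If the chart is chosen so that the complement `0 × ℂⁿ` is `Ker p`, then `φ_p` is the linear map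
which places `A` in the lower left block; this gives the trace formula. An element `g` maps the
chart of a splitting `e` to the chart of `e ∘ g⁻¹` without changing coordinates, which gives
holomorphy and equivariance. Finally `Y` can be brought to any matrix of the same rank by changing
the bases of `z` and of a complement independently, so the orbits are the sets of constant rank.
-/

namespace GrBundles

/-! ### Linear algebra and vector bundles -/

section LinearAlgebra

variable {k E E' F F' : Type*} [Field k]
  [AddCommGroup E] [Module k E] [AddCommGroup E'] [Module k E']
  [AddCommGroup F] [Module k F] [AddCommGroup F'] [Module k F']

theorem exists_finrank_range_eq {m : ℕ} (h : m ≤ Module.finrank k E) :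
    ∃ f : E →ₗ[k] E, Module.finrank k (LinearMap.range f) = m := by
  obtain ⟨s, hs, hli⟩ := exists_finset_linearIndependent_of_le_finrank h
  obtain ⟨W, hW⟩ := (Submodule.span k (s : Set E)).exists_isCompl
  refine ⟨Submodule.projection _ W hW, ?_⟩
  rw [Submodule.range_projection, finrank_span_finset_eq_card hli, hs]

theorem exists_linearEquiv_extending {p q : Submodule k E} {p' q' : Submodule k E'}
    (h : IsCompl p q) (h' : IsCompl p' q') (a : p ≃ₗ[k] p') (b : q ≃ₗ[k] q') :
    ∃ P : E ≃ₗ[k] E', (∀ x : p, P x = a x) ∧ ∀ x : q, P x = b x :=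
  ⟨((Submodule.prodEquivOfIsCompl p q h).symm.trans (a.prodCongr b)).trans
    (Submodule.prodEquivOfIsCompl p' q' h'), fun x => by simp, fun x => by simp⟩

theorem exists_linearEquiv_comp_eq [FiniteDimensional k E] [FiniteDimensional k E']
    [FiniteDimensional k F] [FiniteDimensional k F'] {f : E →ₗ[k] F} {f' : E' →ₗ[k] F'}
    (hE : Module.finrank k E = Module.finrank k E') (hF : Module.finrank k F = Module.finrank k F')
    (hf : Module.finrank k (LinearMap.range f) = Module.finrank k (LinearMap.range f')) :
    ∃ (P : F ≃ₗ[k] F') (Q : E ≃ₗ[k] E'), ∀ x, P (f x) = f' (Q x) := by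
  obtain ⟨C, hC⟩ := (LinearMap.ker f).exists_isCompl
  obtain ⟨C', hC'⟩ := (LinearMap.ker f').exists_isCompl
  obtain ⟨D, hD⟩ := (LinearMap.range f).exists_isCompl
  obtain ⟨D', hD'⟩ := (LinearMap.range f').exists_isCompl
  have hker : Module.finrank k (LinearMap.ker f) = Module.finrank k (LinearMap.ker f') := by
    linarith [f.finrank_range_add_finrank_ker, f'.finrank_range_add_finrank_ker]
  have hcoker : Module.finrank k D = Module.finrank k D' := by
    linarith [Submodule.finrank_add_eq_of_isCompl hD, Submodule.finrank_add_eq_of_isCompl hD']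
  let a := LinearEquiv.ofFinrankEq (R := k) _ _ hf
  let r := f.kerComplementEquivRange hC.symm
  let r' := f'.kerComplementEquivRange hC'.symm
  obtain ⟨P, hPrange, -⟩ := exists_linearEquiv_extending hD hD' a (.ofFinrankEq _ _ hcoker)
  let c := LinearEquiv.ofFinrankEq (R := k) _ _ hker
  obtain ⟨Q, hQker, hQC⟩ := exists_linearEquiv_extending hC hC' c ((r.trans a).trans r'.symm)
  refine ⟨P, Q, fun x => ?_⟩
  obtain ⟨u, v, hu, hv, rfl⟩ := Submodule.codisjoint_iff_exists_add_eq.1 hC.codisjoint x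
  have hfu : f u = 0 := hu
  have hQu : f' (Q u) = 0 := by
    rw [hQker ⟨u, hu⟩]
    exact (c ⟨u, hu⟩).2
  have hQv : f' (Q v) = a (r ⟨v, hv⟩) := by
    rw [hQC ⟨v, hv⟩]
    exact congrArg Subtype.val (r'.apply_symm_apply _)
  rw [map_add, hfu, zero_add, map_add, map_add, hQu, hQv, zero_add]
  exact hPrange (r ⟨v, hv⟩)

end LinearAlgebra

section Trace

theorem eq_zero_of_forall_trace_comp_eq_zero {R E F : Type*} [CommRing R]
    [AddCommGroup E] [Module R E] [AddCommGroup F] [Module R F] [Module.Free R F]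
    [Module.Finite R F] {f : E →ₗ[R] F}
    (h : ∀ g : F →ₗ[R] E, LinearMap.trace R F (f ∘ₗ g) = 0) : f = 0 := by
  ext y
  refine (Module.forall_dual_apply_eq_zero_iff R (f y)).1 fun φ => ?_
  have hφ : f ∘ₗ φ.smulRight y = φ.smulRight (f y) :=
    LinearMap.ext fun x => map_smul f (φ x) y
  rw [← LinearMap.trace_smulRight, ← hφ, h]

variable (𝕜 E : Type*) [NontriviallyNormedField 𝕜] [CompleteSpace 𝕜] [NormedAddCommGroup E]
  [NormedSpace 𝕜 E] [FiniteDimensional 𝕜 E]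

/-- The trace of an endomorphism of a finite-dimensional space, as a continuous functional. -/
noncomputable def traceCLM : (E →L[𝕜] E) →L[𝕜] 𝕜 :=
  LinearMap.toContinuousLinearMap (LinearMap.trace 𝕜 E ∘ₗ ContinuousLinearMap.coeLM 𝕜)

/-- The self-duality `Y ↦ (X ↦ Tr (Y X))` of the space of endomorphisms. -/
noncomputable def traceDual : (E →L[𝕜] E) ≃ₗ[𝕜] ((E →L[𝕜] E) →L[𝕜] 𝕜) :=
  LinearEquiv.ofInjectiveOfFinrankEq
    (ContinuousLinearMap.compL 𝕜 (E →L[𝕜] E) (E →L[𝕜] E) 𝕜 (traceCLM 𝕜 E) ∘L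
      ContinuousLinearMap.compL 𝕜 E E E).toLinearMap
    (by
      rw [injective_iff_map_eq_zero]
      intro Y hY
      refine ContinuousLinearMap.coe_injective (eq_zero_of_forall_trace_comp_eq_zero fun g => ?_)
      exact DFunLike.congr_fun hY (LinearMap.toContinuousLinearMap g))
    (by
      rw [← (LinearMap.toContinuousLinearMap (𝕜 := 𝕜) (E := E →L[𝕜] E) (F' := 𝕜)).finrank_eq]
      exact Subspace.dual_finrank_eq.symm)

variable {𝕜 E}

theorem traceDual_apply (Y X : E →L[𝕜] E) : traceDual 𝕜 E Y X = traceCLM 𝕜 E (Y ∘L X) := rfl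

theorem traceCLM_comp_comm (Y X : E →L[𝕜] E) : traceCLM 𝕜 E (Y ∘L X) = traceCLM 𝕜 E (X ∘L Y) :=
  LinearMap.trace_mul_comm 𝕜 (Y : E →ₗ[𝕜] E) (X : E →ₗ[𝕜] E)

theorem traceCLM_comp_comp_of_intertwining {a d d' T X : E →L[𝕜] E} (Y : E →L[𝕜] E)
    (hT : T ∘L a = d' ∘L X) (hd : d ∘L d' = ContinuousLinearMap.id 𝕜 E) :
    traceCLM 𝕜 E ((a ∘L Y ∘L d) ∘L T) = traceCLM 𝕜 E (Y ∘L X) := by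
  rw [ContinuousLinearMap.comp_assoc, traceCLM_comp_comm, ContinuousLinearMap.comp_assoc,
    ContinuousLinearMap.comp_assoc, hT, ← ContinuousLinearMap.comp_assoc d, hd,
    ContinuousLinearMap.id_comp]

end Trace

section TotalSpace

variable {𝕜 : Type*} [NontriviallyNormedField 𝕜] {m : WithTop ℕ∞}
  {EB HB B : Type*} [NormedAddCommGroup EB] [NormedSpace 𝕜 EB] [TopologicalSpace HB]
  {IB : ModelWithCorners 𝕜 EB HB} [TopologicalSpace B] [ChartedSpace HB B]
  {EB' HB' B' : Type*} [NormedAddCommGroup EB'] [NormedSpace 𝕜 EB'] [TopologicalSpace HB']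
  {IB' : ModelWithCorners 𝕜 EB' HB'} [TopologicalSpace B'] [ChartedSpace HB' B']
  {F : Type*} [NormedAddCommGroup F] [NormedSpace 𝕜 F] {E : B → Type*}
  [∀ b, TopologicalSpace (E b)] [TopologicalSpace (TotalSpace F E)] [FiberBundle F E]
  {F' : Type*} [NormedAddCommGroup F'] [NormedSpace 𝕜 F'] {E' : B' → Type*}
  [∀ b, TopologicalSpace (E' b)] [TopologicalSpace (TotalSpace F' E')] [FiberBundle F' E']

theorem contMDiffAt_totalSpace_of_coordinates {f : TotalSpace F E → TotalSpace F' E'}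
    {σ : B → B'} (hf : ∀ y, (f y).1 = σ y.1) {x : TotalSpace F E}
    (hσ : ContMDiffAt IB IB' m σ x.1) {L : B → F →L[𝕜] F'}
    (hL : ContMDiffAt IB 𝓘(𝕜, F →L[𝕜] F') m L x.1)
    (hfL : ∀ᶠ b in 𝓝 x.1, ∀ v : E b, (trivializationAt F' E' (f x).1 (f ⟨b, v⟩)).2 =
      L b (trivializationAt F E x.1 ⟨b, v⟩).2) :
    ContMDiffAt (IB.prod 𝓘(𝕜, F)) (IB'.prod 𝓘(𝕜, F')) m f x := by
  have hproj : ContMDiffAt (IB.prod 𝓘(𝕜, F)) IB m (fun y : TotalSpace F E => y.1) x :=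
    contMDiffAt_proj E
  have hcoord : ContMDiffAt (IB.prod 𝓘(𝕜, F)) 𝓘(𝕜, F) m
      (fun y => (trivializationAt F E x.1 y).2) x :=
    (contMDiffAt_totalSpace.1 contMDiffAt_id).2
  refine contMDiffAt_totalSpace.2 ⟨?_, ?_⟩
  · rw [funext hf]
    exact hσ.comp x hproj
  · refine ((hL.comp x hproj).clm_apply hcoord).congr_of_eventuallyEq ?_
    filter_upwards [(FiberBundle.continuous_proj F E).continuousAt.eventually hfL] with y hy
    exact hy y.2

end TotalSpace

variable {n : ℕ}

/-! ### Charts of the Grassmannian and their transition maps -/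

theorem mem_source_graph (e : Split n) (A : M n) : graph e A ∈ (grChart e).source := ⟨A, rfl⟩

theorem grChart_graph (e : Split n) (A : M n) : grChart e (graph e A) = A :=
  (grChart e).right_inv (mem_univ A)

theorem graph_grChart {e : Split n} {z : Gr n} (h : z ∈ (grChart e).source) :
    graph e (grChart e z) = z :=
  (grChart e).left_inv h

theorem source_mem_nhds {e : Split n} {z : Gr n} (h : z ∈ (grChart e).source) :
    (grChart e).source ∈ 𝓝 z :=
  (isOpen_source e).mem_nhds h

theorem contMDiffAt_grChart {e : Split n} {z : Gr n} (h : z ∈ (grChart e).source) :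
    ContMDiffAt 𝓘(ℂ, M n) 𝓘(ℂ, M n) ω (grChart e) z :=
  (contMDiffOn_grChart e).contMDiffAt (source_mem_nhds h)

theorem contMDiff_graph (e : Split n) : ContMDiff 𝓘(ℂ, M n) 𝓘(ℂ, M n) ω (graph e) :=
  contMDiffOn_univ.1 <| contMDiffOn_symm_of_mem_maximalAtlas
    (e := (grCore n).openPartialHomeomorph (grChart e) ⟨e, rfl⟩)
    (IsManifold.subset_maximalAtlas ((mem_atlas_iff _).2 ⟨e, rfl⟩))

section Target

variable {G H N : Type*} [NormedAddCommGroup G] [NormedSpace ℂ G] [TopologicalSpace H]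
  {J : ModelWithCorners ℂ G H} [TopologicalSpace N] {f : Gr n → N} {z : Gr n}

theorem contMDiffAt_of_comp_graph [ChartedSpace H N] {e : Split n} (hz : z ∈ (grChart e).source)
    (hf : ContMDiffAt 𝓘(ℂ, M n) J ω (fun A => f (graph e A)) (grChart e z)) :
    ContMDiffAt 𝓘(ℂ, M n) J ω f z := by
  refine (hf.comp z (contMDiffAt_grChart hz)).congr_of_eventuallyEq ?_
  filter_upwards [source_mem_nhds hz] with y hy
  exact congrArg f (graph_grChart hy).symm

theorem mfderiv_eq_fderiv_comp_graph [ChartedSpace G N]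
    (hf : MDifferentiableAt 𝓘(ℂ, M n) 𝓘(ℂ, G) f z) :
    mfderiv 𝓘(ℂ, M n) 𝓘(ℂ, G) f z =
      fderiv ℂ (fun A => chartAt G (f z) (f (graph (splitAt z) A))) (grChart (splitAt z) z) := by
  rw [hf.mfderiv]
  change fderivWithin ℂ (fun A => chartAt G (f z) (f (graph (splitAt z) A))) (range id)
    (grChart (splitAt z) z) = _
  rw [range_id, fderivWithin_univ]

end Target

/-- The change of coordinates from the chart of `e` to the chart of `e'`, which is meaningful at
the matrices `A` such that `graph e A` lies in the domain of the latter. -/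
noncomputable def transition (e e' : Split n) (A : M n) : M n := grChart e' (graph e A)

theorem transition_grChart {e : Split n} (e' : Split n) {z : Gr n} (h : z ∈ (grChart e).source) :
    transition e e' (grChart e z) = grChart e' z := by
  rw [transition, graph_grChart h]

section Transition

variable {e e' : Split n} {A : M n}

theorem eventually_graph_mem_source (h : graph e A ∈ (grChart e').source) :
    ∀ᶠ B in 𝓝 A, graph e B ∈ (grChart e').source :=
  (contMDiff_graph e).continuous.continuousAt.eventually_mem (source_mem_nhds h)

theorem differentiableAt_transition (h : graph e A ∈ (grChart e').source) :
    DifferentiableAt ℂ (transition e e') A :=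
  ((contDiffOn_trans e e').contDiffAt
    ((isOpen_trans_source e e').mem_nhds ⟨mem_univ A, h⟩)).differentiableAt (by simp)

theorem hasFDerivAt_graphMap (e : Split n) (A : M n) :
    HasFDerivAt (graphMap e) (ContinuousLinearMap.compL ℂ (K n) (K n) (V n) (inr e)) A := by
  have haffine : graphMap e = fun B =>
      graphMap e 0 + ContinuousLinearMap.compL ℂ (K n) (K n) (V n) (inr e) B := by
    ext1 B
    ext1 k
    change graphMap e B k = graphMap e 0 k + inr e (B k)
    rw [graphMap_apply, graphMap_apply, inr_apply, ← map_add]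
    simp
  rw [haffine]
  exact (ContinuousLinearMap.hasFDerivAt _).const_add _

theorem blockB_eq_comp_blockA (h : graph e A ∈ (grChart e').source) :
    blockB e e' A = transition e e' A ∘L blockA e e' A :=
  ContinuousLinearMap.ext fun k => (mem_iff_of_mem_source h).1 ⟨k, rfl⟩

theorem fderiv_transition_comp_blockA (h : graph e A ∈ (grChart e').source) (X : M n) :
    fderiv ℂ (transition e e') A X ∘L blockA e e' A = blockD e' e (transition e e' A) ∘L X := by
  have hgraph (T : V n →L[ℂ] K n) : HasFDerivAt (fun B => T ∘L graphMap e B)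
      (ContinuousLinearMap.compL ℂ (K n) (V n) (K n) T ∘L
        ContinuousLinearMap.compL ℂ (K n) (K n) (V n) (inr e)) A :=
    (ContinuousLinearMap.compL ℂ (K n) (V n) (K n) T).hasFDerivAt.comp A (hasFDerivAt_graphMap e A)
  have hA := hgraph (ContinuousLinearMap.fst ℂ (K n) (K n) ∘L (e' : V n →L[ℂ] K n × K n))
  have hB := hgraph (ContinuousLinearMap.snd ℂ (K n) (K n) ∘L (e' : V n →L[ℂ] K n × K n))
  have hprod := (differentiableAt_transition h).hasFDerivAt.clm_comp hA
  have heq := hB.unique (hprod.congr_of_eventuallyEq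
    ((eventually_graph_mem_source h).mono fun B hB => blockB_eq_comp_blockA hB))
  ext1 k
  have hk : (e' (inr e (X k))).2 = fderiv ℂ (transition e e') A X (e' (graphMap e A k)).1 +
      transition e e' A (e' (inr e (X k))).1 := by
    have h := DFunLike.congr_fun (DFunLike.congr_fun heq X) k
    simpa [add_comm] using h
  exact (sub_eq_of_eq_add hk).symm

theorem blockD_comp_blockD {z : Gr n} (h : z ∈ (grChart e).source)
    (h' : z ∈ (grChart e').source) :
    blockD e e' (grChart e z) ∘L blockD e' e (grChart e' z) = ContinuousLinearMap.id ℂ (K n) := by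
  ext1 k
  change coker e (grChart e z) (inr e' (coker e' (grChart e' z) (inr e k))) = k
  have hcoker := coker_eq_zero h (sub_inr_coker_mem h' (inr e k))
  rw [map_sub, coker_inr, sub_eq_zero] at hcoker
  exact hcoker.symm

theorem trivN_change {z : Gr n} (h : z ∈ (grChart e).source)
    (h' : z ∈ (grChart e').source) (Z : NFib z) :
    trivN e' z h' Z = (framesN n).change e e' (grChart e z) (trivN e z h Z) := by
  rw [(framesN n).change_apply e e' z h h']
  exact congrArg (trivN e' z h') ((trivN e z h).symm_apply_apply Z).symm

theorem traceDual_trivN_fderiv_transition {z : Gr n} (h : z ∈ (grChart e).source)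
    (h' : z ∈ (grChart e').source) (Z : NFib z) (X : M n) :
    traceDual ℂ (K n) (trivN e' z h' Z) (fderiv ℂ (transition e e') (grChart e z) X) =
      traceDual ℂ (K n) (trivN e z h Z) X := by
  have hT := fderiv_transition_comp_blockA (e := e) (e' := e') (A := grChart e z)
    (by rwa [graph_grChart h]) X
  rw [transition_grChart e' h] at hT
  rw [traceDual_apply, traceDual_apply, trivN_change h h']
  exact traceCLM_comp_comp_of_intertwining _ hT (blockD_comp_blockD h h')

end Transition

/-! ### The fibrewise isomorphisms `N_z ≅ T*_z Gr` and `N_z ≅ E_z ⊗ E_z^⊥` -/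

theorem trivializationAt_N {z₀ z : Gr n} (h : z ∈ (grChart (splitAt z₀)).source) (Z : NFib z) :
    (trivializationAt (M n) (NFib (n := n)) z₀ ⟨z, Z⟩).2 = trivN (splitAt z₀) z h Z :=
  (Prod.ext_iff.1 ((framesN n).pretriv_apply (splitAt z₀) z h Z)).2

theorem trivializationAt_EP {z₀ z : Gr n} (h : z ∈ (grChart (splitAt z₀)).source) (t : EPFib z) :
    (trivializationAt (Fin n × Fin n → ℂ) (EPFib (n := n)) z₀ ⟨z, t⟩).2 =
      trivEP (splitAt z₀) z h t :=
  (Prod.ext_iff.1 ((framesEP n).pretriv_apply (splitAt z₀) z h t)).2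

theorem symmL_trivializationAt_tangentSpace {z₀ z : Gr n}
    (h : z ∈ (grChart (splitAt z₀)).source) :
    (trivializationAt (M n) (TangentSpace 𝓘(ℂ, M n) (M := Gr n)) z₀).symmL ℂ z =
      fderiv ℂ (transition (splitAt z₀) (splitAt z)) (grChart (splitAt z₀) z) := by
  rw [TangentBundle.symmL_trivializationAt_eq_core h, tangentBundleCore_coordChange_achart]
  change fderivWithin ℂ (transition (splitAt z₀) (splitAt z)) (range id)
    (grChart (splitAt z₀) z) = _
  rw [range_id, fderivWithin_univ]

theorem trivializationAt_Cot {z₀ z : Gr n} (h : z ∈ (grChart (splitAt z₀)).source)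
    (α : CotFib z) (X : M n) :
    (trivializationAt (M n →L[ℂ] ℂ) (CotFib (n := n)) z₀ ⟨z, α⟩).2 X =
      α (fderiv ℂ (transition (splitAt z₀) (splitAt z)) (grChart (splitAt z₀) z) X) := by
  have htrivial (c : ℂ) :
      (trivializationAt ℂ (Bundle.Trivial (Gr n) ℂ) z₀).continuousLinearMapAt ℂ z c = c :=
    DFunLike.congr_fun (Bundle.Trivial.continuousLinearMapAt_trivialization ℂ (Gr n) ℂ z) c
  exact (htrivial _).trans
    (congrArg α (DFunLike.congr_fun (symmL_trivializationAt_tangentSpace h) X))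

theorem isVectorBundleIso_of_coordinates {F F' : Type} {E E' : Gr n → Type}
    [∀ z, AddCommGroup (E z)] [∀ z, Module ℂ (E z)] [∀ z, TopologicalSpace (E z)]
    [∀ z, AddCommGroup (E' z)] [∀ z, Module ℂ (E' z)] [∀ z, TopologicalSpace (E' z)]
    [NormedAddCommGroup F] [NormedSpace ℂ F]
    [TopologicalSpace (TotalSpace F E)] [FiberBundle F E] [VectorBundle ℂ F E]
    [NormedAddCommGroup F'] [NormedSpace ℂ F']
    [TopologicalSpace (TotalSpace F' E')] [FiberBundle F' E'] [VectorBundle ℂ F' E']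
    (f : ∀ z, E z ≃ₗ[ℂ] E' z) (L : F ≃L[ℂ] F')
    (h : ∀ z₀ z : Gr n, z ∈ (grChart (splitAt z₀)).source → ∀ v : E z,
      (trivializationAt F' E' z₀ ⟨z, f z v⟩).2 = L (trivializationAt F E z₀ ⟨z, v⟩).2) :
    IsVectorBundleIso F F' f where
  holomorphic x :=
    contMDiffAt_totalSpace_of_coordinates (f := totalMap F F' f) (σ := id)
      (L := fun _ => (L : F →L[ℂ] F')) (fun _ => rfl) contMDiffAt_id contMDiffAt_const
      (Filter.eventually_of_mem (source_mem_nhds (mem_splitAt x.1)) (h x.1))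
  holomorphic_symm x :=
    contMDiffAt_totalSpace_of_coordinates (f := totalMap F' F fun z => (f z).symm) (σ := id)
      (L := fun _ => (L.symm : F' →L[ℂ] F)) (fun _ => rfl) contMDiffAt_id contMDiffAt_const
      (Filter.eventually_of_mem (source_mem_nhds (mem_splitAt x.1)) fun z hz v => by
        change (trivializationAt F E x.1 ⟨z, (f z).symm v⟩).2 =
          L.symm (trivializationAt F' E' x.1 ⟨z, v⟩).2
        rw [ContinuousLinearEquiv.eq_symm_apply, ← h x.1 z hz, LinearEquiv.apply_symm_apply])

/-- The isomorphism of `N_z` with the cotangent space at `z` which in every chart is the trace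
pairing `Y ↦ (X ↦ Tr (Y X))`. -/
noncomputable def toCot (z : Gr n) : NFib z ≃ₗ[ℂ] CotFib z :=
  (trivN (splitAt z) z (mem_splitAt z)).trans (traceDual ℂ (K n))

theorem toCot_apply_fderiv_transition {e : Split n} {z : Gr n} (h : z ∈ (grChart e).source)
    (Z : NFib z) (X : M n) :
    toCot z Z (fderiv ℂ (transition e (splitAt z)) (grChart e z) X) =
      traceDual ℂ (K n) (trivN e z h Z) X :=
  traceDual_trivN_fderiv_transition h (mem_splitAt z) Z X

theorem isVectorBundleIso_toCot : IsVectorBundleIso (M n) (M n →L[ℂ] ℂ) (toCot (n := n)) :=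
  isVectorBundleIso_of_coordinates _ (traceDual ℂ (K n)).toContinuousLinearEquiv fun z₀ z h Z => by
    ext1 X
    rw [trivializationAt_Cot h, trivializationAt_N h]
    exact toCot_apply_fderiv_transition h Z X

/-- The matrix entries of an endomorphism of `ℂⁿ`. -/
noncomputable def entries (n : ℕ) : M n ≃ₗ[ℂ] (Fin n × Fin n → ℂ) :=
  (LinearMap.toContinuousLinearMap.symm.trans LinearMap.toMatrix').trans
    (LinearEquiv.curry ℂ ℂ (Fin n) (Fin n)).symm

theorem entries_apply (Y : M n) (i j : Fin n) : entries n Y (i, j) = Y (Pi.single j 1) i :=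
  LinearMap.toMatrix'_apply (Y : K n →ₗ[ℂ] K n) i j

theorem rankOne_mem_nilp {z : Gr n} (w : EFib z) (φ : PFib z) :
    rankOne (w : V n) φ.1 ∈ nilp z := by
  constructor
  · rintro _ ⟨v, rfl⟩
    exact z.space.smul_mem _ w.2
  · intro v hv
    change φ.1 v • (w : V n) = 0
    rw [φ.2 v hv, zero_smul]

/-- The map `w ⊗ φ ↦ (v ↦ φ(v) w)`. -/
noncomputable def ofTensor (z : Gr n) : EPFib z →ₗ[ℂ] NFib z :=
  TensorProduct.lift <| LinearMap.mk₂ ℂ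
    (fun w φ => ⟨rankOne (w : V n) φ.1, rankOne_mem_nilp w φ⟩)
    (fun w w' φ => Subtype.ext <| ContinuousLinearMap.ext fun v => smul_add (φ.1 v) w.1 w'.1)
    (fun c w φ => Subtype.ext <| ContinuousLinearMap.ext fun v => smul_comm (φ.1 v) c w.1)
    (fun w φ φ' => Subtype.ext <| ContinuousLinearMap.ext fun v => add_smul (φ.1 v) (φ'.1 v) w.1)
    (fun c w φ => Subtype.ext <| ContinuousLinearMap.ext fun v => smul_assoc c (φ.1 v) w.1)

theorem trivEP_tmul {e : Split n} {z : Gr n} (h : z ∈ (grChart e).source) (w : EFib z)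
    (φ : PFib z) (i j : Fin n) :
    trivEP e z h (w ⊗ₜ[ℂ] φ) (i, j) = trivE e z h w i * trivP e z h φ j := by
  change ((Pi.basisFun ℂ (Fin n)).tensorProduct (Pi.basisFun ℂ (Fin n))).repr
    (trivE e z h w ⊗ₜ[ℂ] trivP e z h φ) (i, j) = _
  simp [mul_comm]

theorem entries_trivN_ofTensor {e : Split n} {z : Gr n} (h : z ∈ (grChart e).source)
    (t : EPFib z) : entries n (trivN e z h (ofTensor z t)) = trivEP e z h t := by
  have hcomp : (entries n).toLinearMap ∘ₗ (trivN e z h).toLinearMap ∘ₗ ofTensor z =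
      (trivEP e z h).toLinearMap := by
    refine TensorProduct.ext' fun w φ => ?_
    ext ⟨i, j⟩
    change entries n (trivN e z h (ofTensor z (w ⊗ₜ[ℂ] φ))) (i, j) =
      trivEP e z h (w ⊗ₜ[ℂ] φ) (i, j)
    rw [entries_apply, trivEP_tmul]
    change (e (φ.1 (inr e (Pi.single j 1)) • w.1)).1 i = _
    rw [map_smul]
    exact mul_comm _ _
  exact DFunLike.congr_fun hcomp t

theorem bijective_ofTensor (z : Gr n) : Function.Bijective (ofTensor z) := by
  have hcoord : ⇑((trivN (splitAt z) z (mem_splitAt z)).trans (entries n)) ∘ ofTensor z =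
      trivEP (splitAt z) z (mem_splitAt z) :=
    funext (entries_trivN_ofTensor (mem_splitAt z))
  rw [← ((trivN (splitAt z) z (mem_splitAt z)).trans (entries n)).bijective.of_comp_iff', hcoord]
  exact LinearEquiv.bijective _

/-- The isomorphism of `N_z` with `E_z ⊗ E_z^⊥`, inverse to `w ⊗ φ ↦ (v ↦ φ(v) w)`. -/
noncomputable def toTensor (z : Gr n) : NFib z ≃ₗ[ℂ] EPFib z :=
  (LinearEquiv.ofBijective (ofTensor z) (bijective_ofTensor z)).symm

theorem ofTensor_toTensor {z : Gr n} (Z : NFib z) : ofTensor z (toTensor z Z) = Z :=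
  (toTensor z).symm_apply_apply Z

theorem isVectorBundleIso_toTensor :
    IsVectorBundleIso (M n) (Fin n × Fin n → ℂ) (toTensor (n := n)) :=
  isVectorBundleIso_of_coordinates _ (entries n).toContinuousLinearEquiv fun z₀ z h Z => by
    rw [trivializationAt_EP h, trivializationAt_N h, ← entries_trivN_ofTensor, ofTensor_toTensor]
    rfl

/-- The isomorphism of `E_z ⊗ E_z^⊥` with the cotangent space at `z`. -/
noncomputable def tensorToCot (z : Gr n) : EPFib z ≃ₗ[ℂ] CotFib z :=
  (toTensor z).symm.trans (toCot z)

theorem toTensor_trans_tensorToCot (z : Gr n) : (toTensor z).trans (tensorToCot z) = toCot z := by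
  rw [tensorToCot, ← LinearEquiv.trans_assoc, LinearEquiv.self_trans_symm, LinearEquiv.refl_trans]

/-! ### The covector of a nilpotent element in the chart of an idempotent -/

theorem exists_split_of_isCompl {z : Gr n} {c : Submodule ℂ (V n)} (h : IsCompl z.space c) :
    ∃ e : Split n, graph e 0 = z ∧ ∀ w, w ∈ c ↔ (e w).1 = 0 := by
  have hc : Module.finrank ℂ c = n := by
    have hsum := Submodule.finrank_add_eq_of_isCompl h
    rw [z.finrank_eq, Module.finrank_fin_fun] at hsum
    omega
  let a : z.space ≃ₗ[ℂ] K n :=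
    LinearEquiv.ofFinrankEq _ _ (z.finrank_eq.trans (Module.finrank_fin_fun ℂ).symm)
  let b : c ≃ₗ[ℂ] K n := LinearEquiv.ofFinrankEq _ _ (hc.trans (Module.finrank_fin_fun ℂ).symm)
  refine ⟨((Submodule.prodEquivOfIsCompl _ _ h).symm.trans
    (a.prodCongr b)).toContinuousLinearEquiv, ?_, fun w => ?_⟩
  · ext w
    rw [mem_graph, zero_apply]
    exact b.map_eq_zero_iff.trans (Submodule.prodEquivOfIsCompl_symm_apply_snd_eq_zero _ _ h)
  · exact (a.map_eq_zero_iff.trans (Submodule.prodEquivOfIsCompl_symm_apply_fst_eq_zero _ _ h)).symm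

/-- The endomorphism of `ℂ²ⁿ` which in the splitting `e` maps `(x, y)` to `(0, Y x)`. -/
noncomputable def lowerBlock (e : Split n) : M n →L[ℂ] gl n :=
  ContinuousLinearMap.compL ℂ (V n) (K n) (V n) (inr e) ∘L
    (ContinuousLinearMap.compL ℂ (V n) (K n) (K n)).flip
      (ContinuousLinearMap.fst ℂ (K n) (K n) ∘L (e : V n →L[ℂ] K n × K n))

theorem lowerBlock_apply (e : Split n) (Y : M n) (w : V n) :
    lowerBlock e Y w = e.symm (0, Y (e w).1) := rfl

theorem traceForm_lowerBlock {e : Split n} {z : Gr n} (h : z ∈ (grChart e).source) (Z : NFib z)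
    (Y : M n) : traceForm Z (lowerBlock e Y) = traceDual ℂ (K n) (trivN e z h Z) Y :=
  (LinearMap.trace_comp_comm' (((Z : gl n) ∘L inr e ∘L Y : K n →L[ℂ] V n) : K n →ₗ[ℂ] V n)
    ((ContinuousLinearMap.fst ℂ (K n) (K n) ∘L (e : V n →L[ℂ] K n × K n) : V n →L[ℂ] K n) :
      V n →ₗ[ℂ] K n)).symm

section Complement

variable {e : Split n} {c : Submodule ℂ (V n)}

theorem sub_graphMap_mem (hc : ∀ w, w ∈ c ↔ (e w).1 = 0) (B : M n) (w : V n) :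
    w - graphMap e B (e w).1 ∈ c := by
  rw [hc, map_sub, graphMap_apply, e.apply_symm_apply]
  exact sub_self _

theorem isCompl_graph (hc : ∀ w, w ∈ c ↔ (e w).1 = 0) (B : M n) : IsCompl (graph e B).space c := by
  refine ⟨Submodule.disjoint_def.2 ?_, Submodule.codisjoint_iff_exists_add_eq.2 fun w =>
    ⟨_, _, ⟨(e w).1, rfl⟩, sub_graphMap_mem hc B w, add_sub_cancel _ _⟩⟩
  rintro _ ⟨k, rfl⟩ hk
  obtain rfl : k = 0 := by
    simpa only [hc, ContinuousLinearMap.coe_coe, graphMap_apply, e.apply_symm_apply] using hk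
  exact map_zero _

theorem projection_graph (hc : ∀ w, w ∈ c ↔ (e w).1 = 0) {B : M n}
    (h : IsCompl (graph e B).space c) (w : V n) :
    Submodule.projection _ _ h w = graphMap e B (e w).1 := by
  have hw := (Submodule.projection_apply_eq_zero_iff h).2 (sub_graphMap_mem hc B w)
  have hgraph : graphMap e B (e w).1 ∈ (graph e B).space := ⟨(e w).1, rfl⟩
  rwa [map_sub, Submodule.projection_apply_of_mem_left h hgraph, sub_eq_zero] at hw

end Complement

theorem exists_split_phi_graph_eq_lowerBlock {p : gl n} {z : Gr n} (hp : p ∘L p = p)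
    (hr : LinearMap.range (p : V n →ₗ[ℂ] V n) = z.space) :
    ∃ e : Split n, graph e 0 = z ∧ ∀ B, phi p (graph e B) = lowerBlock e B := by
  have hidem : IsIdempotentElem (p : V n →ₗ[ℂ] V n) :=
    congrArg (fun q : gl n => (q : V n →ₗ[ℂ] V n)) hp
  obtain ⟨e, rfl, hker⟩ := exists_split_of_isCompl
    (hr ▸ LinearMap.IsIdempotentElem.isCompl hidem)
  have hpe (w : V n) : p w = graphMap e 0 (e w).1 := by
    rw [← projection_graph hker (isCompl_graph hker 0)]
    conv_lhs => rw [← ContinuousLinearMap.coe_coe p, LinearMap.IsIdempotentElem.eq_projection hidem]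
    congr!
  refine ⟨e, rfl, fun B => ContinuousLinearMap.ext fun w => ?_⟩
  rw [phi, dif_pos (isCompl_graph hker B)]
  change Submodule.projection _ _ _ w - p w = _
  rw [projection_graph hker, hpe, graphMap_apply, graphMap_apply, lowerBlock_apply, ← map_sub]
  simp

theorem toCot_eq_traceForm {p : gl n} {z : Gr n} (Z : NFib z) (hp : p ∘L p = p)
    (hr : LinearMap.range (p : V n →ₗ[ℂ] V n) = z.space) (X : TangentSpace 𝓘(ℂ, M n) z) :
    toCot z Z X = traceForm Z (mfderiv 𝓘(ℂ, M n) 𝓘(ℂ, gl n) (phi p) z X) := by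
  obtain ⟨e, he, hphi⟩ := exists_split_phi_graph_eq_lowerBlock hp hr
  have hz : z ∈ (grChart e).source := ⟨0, he⟩
  have hzz : graph (splitAt z) (grChart (splitAt z) z) ∈ (grChart e).source := by
    rwa [graph_grChart (mem_splitAt z)]
  have hdiff : MDifferentiableAt 𝓘(ℂ, M n) 𝓘(ℂ, gl n) (phi p) z := by
    refine (contMDiffAt_of_comp_graph hz ?_).mdifferentiableAt (by simp)
    simp only [hphi]
    exact (lowerBlock e).contMDiff.contMDiffAt
  have hcoord : (fun A => phi p (graph (splitAt z) A)) =ᶠ[𝓝 (grChart (splitAt z) z)]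
      fun A => lowerBlock e (transition (splitAt z) e A) := by
    filter_upwards [eventually_graph_mem_source hzz] with A hA
    rw [← hphi, transition, graph_grChart hA]
  have hmf : mfderiv 𝓘(ℂ, M n) 𝓘(ℂ, gl n) (phi p) z =
      lowerBlock e ∘L fderiv ℂ (transition (splitAt z) e) (grChart (splitAt z) z) :=
    (mfderiv_eq_fderiv_comp_graph hdiff).trans (hcoord.fderiv_eq.trans
      ((lowerBlock e).hasFDerivAt.comp _ (differentiableAt_transition hzz).hasFDerivAt).fderiv)
  rw [hmf]
  change _ = traceForm Z (lowerBlock e _)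
  rw [traceForm_lowerBlock hz]
  exact (traceDual_trivN_fderiv_transition (mem_splitAt z) hz Z X).symm

/-! ### The group action in charts -/

theorem mem_smul_iff {g : GL2 n} {z : Gr n} {w : V n} : w ∈ (g • z).space ↔ g.symm w ∈ z.space :=
  ⟨inv_mem_of_mem_smul g, fun h => by simpa using mem_smul_of_mem g h⟩

theorem smul_graph (g : GL2 n) (e : Split n) (A : M n) :
    g • graph e A = graph (g.symm.trans e) A := by
  ext w
  rw [mem_smul_iff, mem_graph, mem_graph]
  rfl

theorem smul_mem_source {e : Split n} {z : Gr n} (g : GL2 n) (h : z ∈ (grChart e).source) :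
    g • z ∈ (grChart (g.symm.trans e)).source := by
  obtain ⟨A, rfl⟩ := h
  exact ⟨A, (smul_graph g e A).symm⟩

theorem grChart_smul {e : Split n} {z : Gr n} (g : GL2 n) (h : z ∈ (grChart e).source) :
    grChart (g.symm.trans e) (g • z) = grChart e z := by
  obtain ⟨A, rfl⟩ := h
  rw [smul_graph, grChart_graph, grChart_graph]

theorem contMDiff_smul (g : GL2 n) :
    ContMDiff 𝓘(ℂ, M n) 𝓘(ℂ, M n) ω (fun z : Gr n => g • z) := by
  refine fun z => contMDiffAt_of_comp_graph (mem_splitAt z) ?_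
  simp only [smul_graph]
  exact (contMDiff_graph _).contMDiffAt

theorem mfderiv_smul (g : GL2 n) (z : Gr n) :
    mfderiv 𝓘(ℂ, M n) 𝓘(ℂ, M n) (fun z : Gr n => g • z) z =
      fderiv ℂ (transition (g.symm.trans (splitAt z)) (splitAt (g • z)))
        (grChart (splitAt z) z) := by
  rw [mfderiv_eq_fderiv_comp_graph ((contMDiff_smul g).mdifferentiable (by simp) z)]
  simp only [smul_graph]
  rfl

/-- The biholomorphism `σ_g` of the Grassmannian. -/
noncomputable def smulDiffeomorph (g : GL2 n) :
    Diffeomorph 𝓘(ℂ, M n) 𝓘(ℂ, M n) (Gr n) (Gr n) ω where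
  toEquiv := MulAction.toPerm g
  contMDiff_toFun := contMDiff_smul g
  contMDiff_invFun := contMDiff_smul g⁻¹

theorem isInvertible_mfderiv_smul (g : GL2 n) (z : Gr n) :
    (mfderiv 𝓘(ℂ, M n) 𝓘(ℂ, M n) (fun z : Gr n => g • z) z).IsInvertible :=
  ⟨(smulDiffeomorph g).mfderivToContinuousLinearEquiv (by simp) z, rfl⟩

theorem trivN_actN (g : GL2 n) {e : Split n} {z : Gr n} (h : z ∈ (grChart e).source)
    (Z : NFib z) :
    trivN (g.symm.trans e) (g • z) (smul_mem_source g h) (actN g z Z) = trivN e z h Z := by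
  ext1 y
  change (e (g.symm (g (Z.1 (g.symm (g (e.symm (0, y)))))))).1 = (e (Z.1 (e.symm (0, y)))).1
  rw [g.symm_apply_apply, g.symm_apply_apply]

theorem totalSpace_N_ext {x y : TotalSpace (M n) (NFib (n := n))} (h : x.1 = y.1)
    (h' : (x.2 : gl n) = y.2) : x = y := by
  obtain ⟨z, Z⟩ := x
  obtain ⟨z', Z'⟩ := y
  obtain rfl : z = z' := h
  obtain rfl : Z = Z' := Subtype.ext h'
  rfl

theorem contMDiff_totalAct_actN (g : GL2 n) :
    ContMDiff (𝓘(ℂ, M n).prod 𝓘(ℂ, M n)) (𝓘(ℂ, M n).prod 𝓘(ℂ, M n)) ω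
      (totalAct (M n) (actN (n := n)) g) := by
  intro x
  refine contMDiffAt_totalSpace_of_coordinates (f := totalAct (M n) (actN (n := n)) g)
    (σ := fun z => g • z) (L := fun z => (framesN n).change (g.symm.trans (splitAt x.1))
      (splitAt (g • x.1)) (grChart (splitAt x.1) z)) (fun _ => rfl) (contMDiff_smul g x.1) ?_ ?_
  · exact ((framesN n).contDiff_change _ _).contMDiff.contMDiffAt.comp x.1
      (contMDiffAt_grChart (mem_splitAt x.1))
  · filter_upwards [source_mem_nhds (mem_splitAt x.1),
      (contMDiff_smul g).continuous.continuousAt.eventually_mem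
        (source_mem_nhds (mem_splitAt (g • x.1)))] with z hz hgz Z
    refine (trivializationAt_N (z₀ := g • x.1) hgz (actN g z Z)).trans ?_
    rw [trivN_change (smul_mem_source g hz) hgz, trivN_actN g hz, grChart_smul g hz,
      trivializationAt_N hz]

theorem isVectorBundleAction_actN : IsVectorBundleAction (M n) (actN (n := n)) where
  one x := totalSpace_N_ext (one_smul (GL2 n) x.1) rfl
  mul g h x := totalSpace_N_ext (mul_smul g h x.1) rfl
  holomorphic := contMDiff_totalAct_actN

theorem ofTensor_actEP (g : GL2 n) (z : Gr n) (t : EPFib z) :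
    ofTensor (g • z) (actEP g z t) = actN g z (ofTensor z t) := by
  have hcomp : ofTensor (g • z) ∘ₗ actEP g z = actN g z ∘ₗ ofTensor z :=
    TensorProduct.ext' fun w φ => Subtype.ext <| ContinuousLinearMap.ext fun v =>
      (map_smul g (φ.1 (g.symm v)) w.1).symm
  exact DFunLike.congr_fun hcomp t

theorem toTensor_actN (g : GL2 n) (z : Gr n) (Z : NFib z) :
    toTensor (g • z) (actN g z Z) = actEP g z (toTensor z Z) := by
  rw [← LinearEquiv.eq_symm_apply]
  change _ = ofTensor (g • z) _
  rw [ofTensor_actEP, ofTensor_toTensor]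

theorem toCot_actN_mfderiv_smul (g : GL2 n) (z : Gr n) (Z : NFib z)
    (X : TangentSpace 𝓘(ℂ, M n) z) :
    toCot (g • z) (actN g z Z) (mfderiv 𝓘(ℂ, M n) 𝓘(ℂ, M n) (fun z : Gr n => g • z) z X) =
      toCot z Z X := by
  have h := toCot_apply_fderiv_transition (smul_mem_source g (mem_splitAt z)) (actN g z Z) X
  rw [grChart_smul g (mem_splitAt z), trivN_actN g (mem_splitAt z)] at h
  rw [mfderiv_smul]
  exact h

theorem toCot_actN (g : GL2 n) (z : Gr n) (Z : NFib z) :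
    toCot (g • z) (actN g z Z) = actCot g z (toCot z Z) := by
  ext1 X
  have h := toCot_actN_mfderiv_smul g z Z
    ((mfderiv 𝓘(ℂ, M n) 𝓘(ℂ, M n) (fun z : Gr n => g • z) z).inverse X)
  rwa [(isInvertible_mfderiv_smul g z).self_apply_inverse] at h

theorem tensorToCot_actEP (g : GL2 n) (z : Gr n) (t : EPFib z) :
    tensorToCot (g • z) (actEP g z t) = actCot g z (tensorToCot z t) := by
  change toCot (g • z) (ofTensor (g • z) (actEP g z t)) = actCot g z (toCot z (ofTensor z t))
  rw [ofTensor_actEP, toCot_actN]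

/-! ### Transport of actions and orbits along isomorphisms -/

section Transport

variable {F F' : Type} {E E' : Gr n → Type}
  [∀ z, AddCommGroup (E z)] [∀ z, Module ℂ (E z)]
  [∀ z, AddCommGroup (E' z)] [∀ z, Module ℂ (E' z)]
  {ρ : ∀ (g : GL2 n) (z : Gr n), E z →ₗ[ℂ] E (g • z)}
  {ρ' : ∀ (g : GL2 n) (z : Gr n), E' z →ₗ[ℂ] E' (g • z)} {f : ∀ z, E z ≃ₗ[ℂ] E' z}

theorem totalMap_totalAct (h : ∀ g z v, f (g • z) (ρ g z v) = ρ' g z (f z v)) (g : GL2 n)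
    (x : TotalSpace F E) :
    totalMap F F' f (totalAct F ρ g x) = totalAct F' ρ' g (totalMap F F' f x) :=
  congrArg (TotalSpace.mk (g • x.1)) (h g x.1 x.2)

theorem totalMap_symm_totalMap (x : TotalSpace F E) :
    totalMap F' F (fun z => (f z).symm) (totalMap F F' f x) = x :=
  congrArg (TotalSpace.mk x.1) ((f x.1).symm_apply_apply x.2)

theorem totalMap_totalMap_symm (x : TotalSpace F' E') :
    totalMap F F' f (totalMap F' F (fun z => (f z).symm) x) = x :=
  congrArg (TotalSpace.mk x.1) ((f x.1).apply_symm_apply x.2)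

theorem totalMap_injective : Function.Injective (totalMap F F' f) :=
  Function.LeftInverse.injective totalMap_symm_totalMap

theorem SplitsIntoOrbits.image {S : ℕ → Set (TotalSpace F E)} (hS : SplitsIntoOrbits ρ S)
    (h : ∀ g z v, f (g • z) (ρ g z v) = ρ' g z (f z v)) :
    SplitsIntoOrbits ρ' (fun k => totalMap F F' f '' S k) := by
  refine ⟨fun y => ?_, fun k hk => ?_⟩
  · obtain ⟨x, rfl⟩ : ∃ x, totalMap F F' f x = y := ⟨_, totalMap_totalMap_symm y⟩
    simpa only [totalMap_injective.mem_set_image] using hS.1 x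
  · obtain ⟨x, hx⟩ := hS.2 k hk
    refine ⟨totalMap F F' f x, ?_⟩
    simp only [hx, orbit, ← range_comp]
    exact congrArg range (funext fun g => totalMap_totalAct h g x)

variable [∀ z, TopologicalSpace (E z)] [∀ z, TopologicalSpace (E' z)]
  [NormedAddCommGroup F] [NormedSpace ℂ F]
  [TopologicalSpace (TotalSpace F E)] [FiberBundle F E] [VectorBundle ℂ F E]
  [NormedAddCommGroup F'] [NormedSpace ℂ F']
  [TopologicalSpace (TotalSpace F' E')] [FiberBundle F' E'] [VectorBundle ℂ F' E']

theorem IsVectorBundleAction.transport (hρ : IsVectorBundleAction F ρ)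
    (hf : IsVectorBundleIso F F' f) (h : ∀ g z v, f (g • z) (ρ g z v) = ρ' g z (f z v)) :
    IsVectorBundleAction F' ρ' := by
  have hconj (g : GL2 n) (y : TotalSpace F' E') : totalAct F' ρ' g y =
      totalMap F F' f (totalAct F ρ g (totalMap F' F (fun z => (f z).symm) y)) := by
    rw [totalMap_totalAct h, totalMap_totalMap_symm]
  refine ⟨fun y => ?_, fun g g' y => ?_, fun g => ?_⟩
  · rw [hconj, hρ.one, totalMap_totalMap_symm]
  · rw [hconj, hconj, hconj g', hρ.mul, totalMap_symm_totalMap]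
  · rw [funext (hconj g)]
    exact hf.holomorphic.comp ((hρ.holomorphic g).comp hf.holomorphic_symm)

theorem IsVectorBundleIso.symm (hf : IsVectorBundleIso F F' f) :
    IsVectorBundleIso F' F (fun z => (f z).symm) :=
  ⟨hf.holomorphic_symm, hf.holomorphic⟩

variable {F'' : Type} {E'' : Gr n → Type}
  [∀ z, AddCommGroup (E'' z)] [∀ z, Module ℂ (E'' z)] [∀ z, TopologicalSpace (E'' z)]
  [NormedAddCommGroup F''] [NormedSpace ℂ F'']
  [TopologicalSpace (TotalSpace F'' E'')] [FiberBundle F'' E''] [VectorBundle ℂ F'' E'']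

theorem IsVectorBundleIso.trans {f' : ∀ z, E' z ≃ₗ[ℂ] E'' z} (hf : IsVectorBundleIso F F' f)
    (hf' : IsVectorBundleIso F' F'' f') :
    IsVectorBundleIso F F'' (fun z => (f z).trans (f' z)) :=
  ⟨hf'.holomorphic.comp hf.holomorphic, hf.holomorphic_symm.comp hf'.holomorphic_symm⟩

end Transport

theorem isVectorBundleIso_tensorToCot :
    IsVectorBundleIso (Fin n × Fin n → ℂ) (M n →L[ℂ] ℂ) (tensorToCot (n := n)) :=
  isVectorBundleIso_toTensor.symm.trans isVectorBundleIso_toCot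

/-! ### Orbits -/

theorem coe_eq_graphMap_comp_trivN {e : Split n} {z : Gr n} (h : z ∈ (grChart e).source)
    (Z : NFib z) :
    (Z : gl n) = graphMap e (grChart e z) ∘L trivN e z h Z ∘L coker e (grChart e z) :=
  (congrArg Subtype.val ((trivN e z h).symm_apply_apply Z)).symm

theorem finrank_range_trivN {e : Split n} {z : Gr n} (h : z ∈ (grChart e).source) (Z : NFib z) :
    Module.finrank ℂ (LinearMap.range (trivN e z h Z : K n →ₗ[ℂ] K n)) =
      Module.finrank ℂ (LinearMap.range ((Z : gl n) : V n →ₗ[ℂ] V n)) := by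
  have hcoker : LinearMap.range (coker e (grChart e z) : V n →ₗ[ℂ] K n) = ⊤ :=
    LinearMap.range_eq_top.2 fun y => ⟨inr e y, coker_inr e _ y⟩
  conv_rhs => rw [coe_eq_graphMap_comp_trivN h Z, ContinuousLinearMap.toLinearMap_comp,
    ContinuousLinearMap.toLinearMap_comp, LinearMap.range_comp,
    LinearMap.range_comp_of_range_eq_top _ hcoker]
  exact (Submodule.equivMapOfInjective _ (graphMap_injective e _) _).finrank_eq

theorem finrank_range_actN (g : GL2 n) (z : Gr n) (Z : NFib z) :
    Module.finrank ℂ (LinearMap.range ((actN g z Z : gl n) : V n →ₗ[ℂ] V n)) =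
      Module.finrank ℂ (LinearMap.range ((Z : gl n) : V n →ₗ[ℂ] V n)) := by
  rw [← finrank_range_trivN (smul_mem_source g (mem_splitAt z)), trivN_actN g (mem_splitAt z),
    finrank_range_trivN]

theorem apply_coe_of_graph_zero {e : Split n} (Z : NFib (graph e 0)) (v : V n) :
    e ((Z : gl n) v) = (trivN e _ (mem_source_graph e 0) Z (e v).2, 0) := by
  conv_lhs => rw [coe_eq_graphMap_comp_trivN (mem_source_graph e 0) Z]
  simp [graphMap_apply, coker_apply, grChart_graph]

theorem exists_totalAct_eq {x x' : TotalSpace (M n) (NFib (n := n))}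
    (h : Module.finrank ℂ (LinearMap.range ((x.2 : gl n) : V n →ₗ[ℂ] V n)) =
      Module.finrank ℂ (LinearMap.range ((x'.2 : gl n) : V n →ₗ[ℂ] V n))) :
    ∃ g, totalAct (M n) (actN (n := n)) g x = x' := by
  obtain ⟨z, Z⟩ := x
  obtain ⟨z', Z'⟩ := x'
  obtain ⟨e, rfl⟩ := exists_split z
  obtain ⟨e', rfl⟩ := exists_split z'
  obtain ⟨P, Q, hPQ⟩ := exists_linearEquiv_comp_eq
    (f := (trivN e _ (mem_source_graph e 0) Z : K n →ₗ[ℂ] K n))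
    (f' := (trivN e' _ (mem_source_graph e' 0) Z' : K n →ₗ[ℂ] K n)) rfl rfl
    (by rw [finrank_range_trivN, finrank_range_trivN]; exact h)
  let g : GL2 n := (e.trans
    (P.toContinuousLinearEquiv.prodCongr Q.toContinuousLinearEquiv)).trans e'.symm
  have hg (v : V n) : e' (g v) = (P (e v).1, Q (e v).2) := e'.apply_symm_apply _
  refine ⟨g, totalSpace_N_ext ?_ ?_⟩
  · ext w
    change w ∈ (g • graph e 0).space ↔ w ∈ (graph e' 0).space
    obtain ⟨v, rfl⟩ := g.surjective w
    rw [mem_smul_iff, mem_graph, mem_graph, hg]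
    simp
  · ext1 w
    obtain ⟨v, rfl⟩ := g.surjective w
    apply e'.injective
    change e' (g ((Z : gl n) (g.symm (g v)))) = e' ((Z' : gl n) (g v))
    rw [g.symm_apply_apply, hg, apply_coe_of_graph_zero, apply_coe_of_graph_zero, hg]
    exact Prod.ext (hPQ _) (map_zero Q)

theorem nonempty_NOrbit {k : ℕ} (hk : k ≤ n) : (NOrbit n k).Nonempty := by
  obtain ⟨e⟩ : Nonempty (Split n) :=
    FiniteDimensional.nonempty_continuousLinearEquiv_of_finrank_eq (by simp; omega)
  obtain ⟨Y, hY⟩ := exists_finrank_range_eq (k := ℂ) (E := K n) (by simpa using hk)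
  refine ⟨⟨graph e 0, (trivN e _ (mem_source_graph e 0)).symm
    (LinearMap.toContinuousLinearMap Y)⟩, ?_⟩
  change Module.finrank ℂ (LinearMap.range (((trivN e _ (mem_source_graph e 0)).symm _ : gl n) :
    V n →ₗ[ℂ] V n)) = k
  rw [← finrank_range_trivN (mem_source_graph e 0), LinearEquiv.apply_symm_apply]
  exact hY

theorem splitsIntoOrbits_NOrbit : SplitsIntoOrbits actN (NOrbit n) := by
  refine ⟨?_, fun k hk => ?_⟩
  · rintro ⟨z, Z⟩
    exact ⟨_, ⟨(Submodule.finrank_mono Z.2.1).trans_eq z.finrank_eq, rfl⟩,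
      fun k hk => hk.2.symm⟩
  · obtain ⟨x, hx⟩ := nonempty_NOrbit hk
    refine ⟨x, Subset.antisymm (fun y hy => exists_totalAct_eq (hx.trans hy.symm)) ?_⟩
    rintro _ ⟨g, rfl⟩
    exact (finrank_range_actN g x.1 x.2).trans hx

end GrBundles

theorem proposition2p3 (n : ℕ) :
    ∃ (Φ : ∀ z : Gr n, NFib z ≃ₗ[ℂ] EPFib z) (Ψ : ∀ z : Gr n, EPFib z ≃ₗ[ℂ] CotFib z),
      (IsVectorBundleIso (M n) (Fin n × Fin n → ℂ) Φ ∧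
        IsVectorBundleIso (Fin n × Fin n → ℂ) (M n →L[ℂ] ℂ) Ψ ∧
        (∀ (z : Gr n) (w : EFib z) (φ : PFib z),
          ((Φ z).symm (w ⊗ₜ[ℂ] φ) : gl n) = rankOne w φ) ∧
        (∀ (z : Gr n) (Z : NFib z) (p : gl n), p ∘L p = p →
          LinearMap.range (p : V n →ₗ[ℂ] V n) = z.space →
          ∀ X : TangentSpace 𝓘(ℂ, M n) z,
            Ψ z (Φ z Z) X = traceForm Z (mfderiv 𝓘(ℂ, M n) 𝓘(ℂ, gl n) (phi p) z X))) ∧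
      (IsVectorBundleAction (M n) (actN (n := n)) ∧
        IsVectorBundleAction (Fin n × Fin n → ℂ) (actEP (n := n)) ∧
        IsVectorBundleAction (M n →L[ℂ] ℂ) (actCot (n := n)) ∧
        (∀ (g : GL2 n) (z : Gr n) (Z : NFib z), Φ (g • z) (actN g z Z) = actEP g z (Φ z Z)) ∧
        (∀ (g : GL2 n) (z : Gr n) (t : EPFib z),
          Ψ (g • z) (actEP g z t) = actCot g z (Ψ z t))) ∧
      (SplitsIntoOrbits actN (NOrbit n) ∧
        SplitsIntoOrbits actEP
          (fun k => totalMap (M n) (Fin n × Fin n → ℂ) Φ '' NOrbit n k) ∧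
        SplitsIntoOrbits actCot
          (fun k => totalMap (M n) (M n →L[ℂ] ℂ) (fun z => (Φ z).trans (Ψ z)) '' NOrbit n k)) := by
  refine ⟨toTensor, tensorToCot,
    ⟨isVectorBundleIso_toTensor, isVectorBundleIso_tensorToCot, fun z w φ => rfl,
      fun z Z p hp hr X => ?_⟩,
    ⟨isVectorBundleAction_actN,
      isVectorBundleAction_actN.transport isVectorBundleIso_toTensor toTensor_actN,
      isVectorBundleAction_actN.transport isVectorBundleIso_toCot toCot_actN,
      toTensor_actN, tensorToCot_actEP⟩,
    splitsIntoOrbits_NOrbit, splitsIntoOrbits_NOrbit.image toTensor_actN, ?_⟩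
  · rw [← LinearEquiv.trans_apply, toTensor_trans_tensorToCot]
    exact toCot_eq_traceForm Z hp hr X
  · simp only [toTensor_trans_tensorToCot]
    exact splitsIntoOrbits_NOrbit.image toCot_actN
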